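/- Let $K$ be a field and let $\mathcal C$ be an additive $K$-category with split idempotents (skeletally small) which is Krull–Schmidt, i.e. every object is a finite direct sum of objects with local endomorphism rings. Let $\operatorname{rad}=\operatorname{rad}_{\mathcal C}$ be its radical, where $\operatorname{rad}(X,Y)$ consists of the $f\colon X\to Y$ such that $gf$ lies in the Jacobson radical of $\operatorname{End}(X)$ for all $g\colon Y\to X$. Assume that for each object $X$ the functor $\operatorname{rad}(-,X)$ is finitely generated, and that $\operatorname{rad}^i(X,Y)/\operatorname{rad}^{i+1}(X,Y)$ is finite dimensional over $K$ for all objects $X,Y$ and all $i\ge 0$ (where $\operatorname{rad}^0=\operatorname{Hom}_{\mathcal C}$). Let $T(\mathcal C)$ be the free tensor category of $\mathcal C$ over the bimodule $M=\operatorname{rad}/\operatorname{rad}^2$: it has the same objects as $\mathcal C$, its morphisms are $\operatorname{Hom}_{T(\mathcal C)}(X,Y)=\bigoplus_{i\ge 0}M^{\otimes i}(X,Y)$, where $M^{\otimes 0}=\operatorname{Hom}_{\mathcal C}/\operatorname{rad}$ and $M^{\otimes (i+1)}(X,Y)=M(-,Y)\otimes_{\mathcal C}M^{\otimes i}(X,-)$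 is the quotient of $\bigoplus_{Z\in\mathcal C}M(Z,Y)\otimes_K M^{\otimes i}(X,Z)$ by the relations $md\otimes t=m\otimes dt$ for all morphisms $d\colon Z\to Z'$ in $\mathcal C$, $m\in M(Z',Y)$ and $t\in M^{\otimes i}(X,Z)$, and composition is concatenation of tensors. (Equivalently, $M^{\otimes (i+1)}(X,Y)$ is the direct sum of the $M(Z,Y)\otimes_{D_Z}M^{\otimes i}(X,Z)$, $D_Z=\operatorname{End}(Z)/\operatorname{rad}(Z,Z)$, over representatives $Z$ of the isomorphism classes of indecomposable objects.) It is a positively graded $K$-category, with degree $i$ part $M^{\otimes i}$. Let $\operatorname{Gr}(T(\mathcal C))$ be the category of $K$-linear graded contravariant functors from $T(\mathcal C)$ to $\mathbb Z$-graded $K$-vector spaces, in which exactness and projectivity are understood with respect to natural transformations of degree zero. Then $\operatorname{Gr}(T(\mathcal C))$ is hereditary, i.e. it has global dimension at most $1$: for every $F$ in $\operatorname{Gr}(T(\mathcal C))$ there is an exact sequence $0\to P_1\to P_0\to F\to 0$ with $P_0$ and $P_1$ projective. Moreover, for every object $X$ the radical $\operatorname{rad}_{T(\mathcal C)}(-,X)=\bigoplus_{i\ge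 1}\operatorname{Hom}_{T(\mathcal C)}(-,X)_i$ of the representable functor $\operatorname{Hom}_{T(\mathcal C)}(-,X)$ is projective in $\operatorname{Gr}(T(\mathcal C))$. -/

import Mathlib

open CategoryTheory CategoryTheory.Limits Opposite
open scoped TensorProduct DirectSum

universe k v u w

/-! ## Ideals and the radical of a `K`-linear category -/

section Ideals

variable (K : Type k) [Field K] (C : Type u) [Category.{v} C] [Preadditive C] [Linear K C]

/-- An ideal of a `K`-linear category: a sub-bifunctor of the `Hom`-functor. -/
structure HomIdeal where
  /-- The morphisms `X ⟶ Y` lying in the ideal. -/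
  carrier (X Y : C) : Submodule K (X ⟶ Y)
  comp_mem {X Y Z : C} (f : X ⟶ Y) (g : Y ⟶ Z) (hf : f ∈ carrier X Y) : f ≫ g ∈ carrier X Z
  mem_comp {X Y Z : C} (f : X ⟶ Y) (g : Y ⟶ Z) (hg : g ∈ carrier Y Z) : f ≫ g ∈ carrier X Z

namespace HomIdeal

variable {K C}

/-- The product `I J` of two ideals: the finite sums of composites `h ∘ g` with `g` in `J` and
`h` in `I`. -/
def mul (I J : HomIdeal K C) : HomIdeal K C where
  carrier X Y := Submodule.span K
    {f | ∃ (A : C) (g : X ⟶ A) (h : A ⟶ Y), g ∈ J.carrier X A ∧ h ∈ I.carrier A Y ∧ f = g ≫ h}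
  comp_mem {X Y Z} f p hf := by
    induction hf using Submodule.span_induction with
    | mem f hf =>
      obtain ⟨A, g, h, hg, hh, rfl⟩ := hf
      exact Submodule.subset_span ⟨A, g, h ≫ p, hg, I.comp_mem _ _ hh, by simp⟩
    | zero => simp
    | add f f' _ _ h h' => simpa using Submodule.add_mem _ h h'
    | smul c f _ h => simpa using Submodule.smul_mem _ c h
  mem_comp {X Y Z} p f hf := by
    induction hf using Submodule.span_induction with
    | mem f hf =>
      obtain ⟨A, g, h, hg, hh, rfl⟩ := hf
      exact Submodule.subset_span ⟨A, p ≫ g, h, J.mem_comp _ _ hg, hh, by simp⟩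
    | zero => simp
    | add f f' _ _ h h' => simpa using Submodule.add_mem _ h h'
    | smul c f _ h => simpa using Submodule.smul_mem _ c h

/-- The powers of an ideal; `I ^ 0` consists of all morphisms. -/
def pow (I : HomIdeal K C) : ℕ → HomIdeal K C
  | 0 =>
    { carrier := fun _ _ => ⊤
      comp_mem := fun _ _ _ => trivial
      mem_comp := fun _ _ _ => trivial }
  | 1 => I
  | n + 2 => I.mul (I.pow (n + 1))

end HomIdeal

/-- In a ring, `x` is in the Jacobson radical iff `1 + y x` has a left inverse for all `y`. -/
theorem mem_ringJacobson_iff {R : Type*} [Ring R] (x : R) :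
    x ∈ Ring.jacobson R ↔ ∀ y : R, ∃ z : R, z * (y * x + 1) = 1 := by
  rw [← Ideal.jacobson_bot, Ideal.mem_jacobson_iff]
  refine forall_congr' fun y => exists_congr fun z => ?_
  rw [Submodule.mem_bot, sub_eq_zero, mul_add, mul_one, mul_assoc]

variable {C} in
/-- The morphisms `f : X ⟶ Y` such that `g ∘ f` is in the Jacobson radical of `End X` for all
`g : Y ⟶ X`. -/
def radicalHom (X Y : C) : Submodule K (X ⟶ Y) where
  carrier := {f | ∀ g : Y ⟶ X, (f ≫ g : End X) ∈ Ring.jacobson (End X)}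
  zero_mem' g := by
    have : ((0 : X ⟶ Y) ≫ g : End X) = (0 : End X) := zero_comp
    rw [this]; exact Submodule.zero_mem _
  add_mem' {f f'} hf hf' g := by
    have : ((f + f') ≫ g : End X) = (f ≫ g : End X) + (f' ≫ g : End X) :=
      Preadditive.add_comp _ _ _ _ _ _
    rw [this]; exact Submodule.add_mem _ (hf g) (hf' g)
  smul_mem' c f hf g := by
    have : ((c • f) ≫ g : End X) = (f ≫ (c • g) : End X) := by simp
    rw [this]; exact hf _

/-- The radical of a `K`-linear category. -/
def catRadical : HomIdeal K C where
  carrier X Y := radicalHom K X Y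
  comp_mem f g hf p := by
    rw [Category.assoc]; exact hf _
  mem_comp {X Y Z} f g hg p := by
    refine (mem_ringJacobson_iff (R := End X) _).2 fun y => ?_
    have key : ∀ (a : X ⟶ Y) (b : Y ⟶ X) (z : Y ⟶ Y), (b ≫ a + 𝟙 Y) ≫ z = 𝟙 Y →
        (a ≫ b + 𝟙 X) ≫ (𝟙 X - a ≫ z ≫ b) = 𝟙 X := by
      intro a b z h
      have h' : a ≫ ((b ≫ a + 𝟙 Y) ≫ z) ≫ b = a ≫ b := by rw [h, Category.id_comp]
      simp only [Preadditive.add_comp, Preadditive.comp_add, Category.assoc, Category.id_comp,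
        Category.comp_id, Preadditive.comp_sub] at h' ⊢
      rw [← h']
      abel
    obtain ⟨z, hz⟩ := (mem_ringJacobson_iff (R := End Y) _).1 (hg (p ≫ y ≫ f)) 1
    rw [one_mul] at hz
    refine ⟨𝟙 X - f ≫ z ≫ g ≫ p ≫ y, ?_⟩
    have hz' : ((g ≫ p ≫ y) ≫ f + 𝟙 Y) ≫ z = 𝟙 Y := by
      simpa only [Category.assoc] using! hz
    have := key f (g ≫ p ≫ y) z hz'
    rw [End.mul_def, End.mul_def]
    simpa only [Category.assoc] using! this

end Ideals

/-! ## Graded categories and graded functors -/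

section Graded

variable (K : Type k) [Field K] (D : Type u) [Category.{v} D] [Preadditive D] [Linear K D]

/-- A `ℤ`-grading of a `K`-linear category. -/
class GradedCategory where
  /-- The morphisms of degree `i`. -/
  deg (X Y : D) (i : ℤ) : Submodule K (X ⟶ Y)
  isInternal (X Y : D) : DirectSum.IsInternal (deg X Y)
  id_mem (X : D) : 𝟙 X ∈ deg X X 0
  comp_mem {X Y Z : D} {i j : ℤ} (f : X ⟶ Y) (g : Y ⟶ Z) (hf : f ∈ deg X Y i)
    (hg : g ∈ deg Y Z j) : f ≫ g ∈ deg X Z (i + j)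

/-- A graded category is positively graded if there are no nonzero morphisms of negative
degree. -/
class IsPositivelyGraded [GradedCategory K D] : Prop where
  deg_eq_bot (X Y : D) (i : ℤ) (hi : i < 0) : GradedCategory.deg (K := K) X Y i = ⊥

/-- The additive graded contravariant functors from a graded category to graded vector spaces:
`K`-linear functors with a grading of each value, such that a morphism of degree `i` acts by a
map of degree `i`. -/
structure GrFunctor [GradedCategory K D] where
  /-- The underlying contravariant functor. -/
  toFunctor : Dᵒᵖ ⥤ ModuleCat.{w} K
  map_add {X Y : D} (f g : X ⟶ Y) :
    toFunctor.map (f + g).op = toFunctor.map f.op + toFunctor.map g.op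
  map_smul {X Y : D} (c : K) (f : X ⟶ Y) : toFunctor.map (c • f).op = c • toFunctor.map f.op
  /-- The elements of degree `j`. -/
  deg (X : D) (j : ℤ) : Submodule K (toFunctor.obj (op X))
  isInternal (X : D) : DirectSum.IsInternal (deg X)
  map_mem {X Y : D} {i j : ℤ} (f : X ⟶ Y) (hf : f ∈ GradedCategory.deg (K := K) X Y i)
    (x : toFunctor.obj (op Y)) (hx : x ∈ deg Y j) : toFunctor.map f.op x ∈ deg X (i + j)

namespace GrFunctor

variable {K D} [GradedCategory K D]

/-- Natural transformations of degree zero. -/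
@[ext]
structure Hom (F G : GrFunctor.{k, v, u, w} K D) where
  /-- The underlying natural transformation. -/
  natTrans : F.toFunctor ⟶ G.toFunctor
  deg_mem (X : D) (i : ℤ) (x : F.toFunctor.obj (op X)) (hx : x ∈ F.deg X i) :
    natTrans.app (op X) x ∈ G.deg X i

/-- The abelian category of graded functors and natural transformations of degree zero. -/
instance : Category (GrFunctor.{k, v, u, w} K D) where
  Hom F G := Hom F G
  id _ := ⟨𝟙 _, fun _ _ _ hx => hx⟩
  comp f g := ⟨f.natTrans ≫ g.natTrans, fun X i x hx => g.deg_mem X i _ (f.deg_mem X i x hx)⟩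
  id_comp _ := Hom.ext (Category.id_comp _)
  comp_id _ := Hom.ext (Category.comp_id _)
  assoc _ _ _ := Hom.ext (Category.assoc _ _ _)

/-- `0 ⟶ L ⟶ P ⟶ F ⟶ 0` is exact. -/
def IsShortExact {L P F : GrFunctor.{k, v, u, w} K D} (i : L ⟶ P) (p : P ⟶ F) : Prop :=
  ∀ X : D, Function.Injective (i.natTrans.app (op X)) ∧
    Function.Exact (i.natTrans.app (op X)) (p.natTrans.app (op X)) ∧
    Function.Surjective (p.natTrans.app (op X))

/-- `F` has a projective resolution of length at most `n`: it is projective if `n = 0`, and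
for `n + 1` there is an exact sequence `0 ⟶ L ⟶ P ⟶ F ⟶ 0` with `P` projective, such that `L`
has a projective resolution of length at most `n`. -/
def HasProjDimLE : ℕ → GrFunctor.{k, v, u, w} K D → Prop
  | 0, F => Projective F
  | n + 1, F => ∃ (L P : GrFunctor.{k, v, u, w} K D) (i : L ⟶ P) (p : P ⟶ F),
      Projective P ∧ IsShortExact i p ∧ HasProjDimLE n L

variable (K D) in
/-- The category of graded functors has global dimension at most `n`. -/
def HasGlobalDimLE (n : ℕ) : Prop :=
  ∀ F : GrFunctor.{k, v, u, w} K D, HasProjDimLE n F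

variable (K) in
/-- The representable graded functor `Hom (-, X)`. -/
def representable (X : D) : GrFunctor.{k, v, u, v} K D where
  toFunctor := (linearYoneda K D).obj X
  map_add f g := by
    ext h
    exact Preadditive.add_comp _ _ _ _ _ _
  map_smul c f := by
    ext h
    exact Linear.smul_comp _ _ _ _ _ _
  deg Y j := GradedCategory.deg (K := K) Y X j
  isInternal Y := GradedCategory.isInternal Y X
  map_mem f hf x hx := GradedCategory.comp_mem f x hf hx

/-- The graded subfunctor `F_{≥ n}` of a graded functor `F` on a positively graded category. -/
def truncGE [IsPositivelyGraded K D] (F : GrFunctor.{k, v, u, w} K D) (n : ℤ) :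
    GrFunctor.{k, v, u, w} K D :=
  have key : ∀ {X Y : D} (f : X ⟶ Y), ∀ x ∈ ⨆ j ≥ n, F.deg Y j,
      F.toFunctor.map f.op x ∈ ⨆ j ≥ n, F.deg X j := by
    intro X Y f x hx
    have hf : f ∈ ⨆ i, GradedCategory.deg (K := K) X Y i :=
      (GradedCategory.isInternal (K := K) X Y).submodule_iSup_eq_top ▸ Submodule.mem_top
    induction hf using Submodule.iSup_induction' with
    | zero =>
      have h0 : F.toFunctor.map (0 : X ⟶ Y).op = 0 := by
        have := F.map_smul (0 : K) (0 : X ⟶ Y)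
        simpa only [zero_smul] using this
      rw [h0]
      exact Submodule.zero_mem _
    | add f g _ _ hf hg =>
      rw [F.map_add]
      exact Submodule.add_mem _ hf hg
    | mem i f hf =>
      by_cases hi : i < 0
      · rw [IsPositivelyGraded.deg_eq_bot X Y i hi, Submodule.mem_bot] at hf
        have h0 : F.toFunctor.map f.op = 0 := by
          have := F.map_smul (0 : K) f
          simpa only [zero_smul, hf] using this
        rw [h0]
        exact Submodule.zero_mem _
      · have : (⨆ j ≥ n, F.deg Y j) ≤ (⨆ j ≥ n, F.deg X j).comap (F.toFunctor.map f.op).hom := by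
          refine iSup₂_le fun j hj y hy => ?_
          have hij : i + j ≥ n := by omega
          exact Submodule.mem_iSup_of_mem (i + j)
            (Submodule.mem_iSup_of_mem hij (F.map_mem f hf y hy))
        exact this hx
  { toFunctor :=
      { obj := fun X => ModuleCat.of K (⨆ j ≥ n, F.deg X.unop j : Submodule K (F.toFunctor.obj X))
        map := fun f => ModuleCat.ofHom ((F.toFunctor.map f).hom.restrict (key f.unop))
        map_id := fun X => ModuleCat.hom_ext <| LinearMap.ext fun x => Subtype.ext <|
          congrArg (fun φ => φ.hom x.1) (F.toFunctor.map_id X)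
        map_comp := fun f g => ModuleCat.hom_ext <| LinearMap.ext fun x => Subtype.ext <|
          congrArg (fun φ => φ.hom x.1) (F.toFunctor.map_comp f g) }
    map_add := fun f g => ModuleCat.hom_ext <| LinearMap.ext fun x => Subtype.ext <|
      congrArg (fun φ => φ.hom x.1) (F.map_add f g)
    map_smul := fun c f => ModuleCat.hom_ext <| LinearMap.ext fun x => Subtype.ext <|
      congrArg (fun φ => φ.hom x.1) (F.map_smul c f)
    deg := fun X j => (F.deg X j).comap (⨆ j ≥ n, F.deg X j).subtype
    isInternal := fun X => by
      have hF := (DirectSum.isInternal_submodule_iff_iSupIndep_and_iSup_eq_top _).1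
        (F.isInternal X)
      refine (DirectSum.isInternal_submodule_iff_iSupIndep_and_iSup_eq_top _).2 ⟨fun i => ?_, ?_⟩
      · refine Submodule.disjoint_def.2 fun x hx hx' => Subtype.ext ?_
        refine Submodule.disjoint_def.1 (hF.1 i) x.1 hx ?_
        have : (⨆ j, ⨆ (_ : j ≠ i), (F.deg X j).comap (⨆ j ≥ n, F.deg X j).subtype) ≤
            (⨆ j, ⨆ (_ : j ≠ i), F.deg X j).comap (⨆ j ≥ n, F.deg X j).subtype :=
          iSup₂_le fun j hj y hy => Submodule.mem_iSup_of_mem j (Submodule.mem_iSup_of_mem hj hy)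
        exact this hx'
      · refine eq_top_iff.2 fun x _ => ?_
        have : (⨆ j ≥ n, F.deg X j) ≤
            (⨆ j, (F.deg X j).comap (⨆ j ≥ n, F.deg X j).subtype).map
              (⨆ j ≥ n, F.deg X j).subtype :=
          iSup₂_le fun j hj y hy =>
            ⟨⟨y, Submodule.mem_iSup_of_mem j (Submodule.mem_iSup_of_mem hj hy)⟩,
              Submodule.mem_iSup_of_mem j hy, rfl⟩
        obtain ⟨y, hy, hyx⟩ := this x.2
        exact Subtype.ext hyx ▸ hy
    map_mem := fun f hf x hx => F.map_mem f hf x.1 hx }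

end GrFunctor

end Graded

/-! ## Krull-Schmidt categories and the associated graded pieces -/

section Hypotheses

/-- Every object is a finite direct sum of objects with local endomorphism rings. -/
def IsKrullSchmidt (C : Type u) [Category.{v} C] [Preadditive C] [HasFiniteBiproducts C] : Prop :=
  ∀ X : C, ∃ (n : ℕ) (Y : Fin n → C), (∀ i, IsLocalRing (End (Y i))) ∧ Nonempty (X ≅ ⨁ Y)

variable (K : Type k) [Field K] {C : Type u} [Category.{v} C] [Preadditive C] [Linear K C]

/-- `rad ^ n (X, Y) / rad ^ (n + 1) (X, Y)`, the degree `n` morphisms `X ⟶ Y` of the associated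
graded category of `C` with respect to its radical. -/
def GrHom (n : ℕ) (X Y : C) : Type v :=
  ((catRadical K C).pow n).carrier X Y ⧸
    (((catRadical K C).pow (n + 1)).carrier X Y).submoduleOf (((catRadical K C).pow n).carrier X Y)

instance (n : ℕ) (X Y : C) : AddCommGroup (GrHom K n X Y) :=
  inferInstanceAs (AddCommGroup (_ ⧸ _))

instance (n : ℕ) (X Y : C) : Module K (GrHom K n X Y) :=
  inferInstanceAs (Module K (_ ⧸ _))

variable (C) in
/-- The associated graded category of `C` is locally finite. -/
def IsAssociatedGradedLocallyFinite : Prop :=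
  ∀ (n : ℕ) (X Y : C), FiniteDimensional K (GrHom K n X Y)

/-- The functor `rad (-, X)` is finitely generated: there are finitely many elements
`f i` in `rad (B i, X)` such that every element of `rad (A, X)` is of the form `∑ i, f i ∘ h i`. -/
def IsRadicalFinitelyGenerated (X : C) : Prop :=
  ∃ (n : ℕ) (B : Fin n → C) (f : ∀ i, B i ⟶ X),
    (∀ i, f i ∈ (catRadical K C).carrier (B i) X) ∧
    ∀ (A : C), ∀ g ∈ (catRadical K C).carrier A X, ∃ h : ∀ i, A ⟶ B i, g = ∑ i, h i ≫ f i

end Hypotheses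

/-! ## The tensor powers of the bimodule `rad / rad ^ 2` -/

noncomputable section Tensor

variable (K : Type k) [Field K] {C : Type u} [Category.{v} C] [Preadditive C] [Linear K C]

/-- Postcomposition with `g` on `rad ^ n / rad ^ (n + 1)`. -/
def GrHom.post (n : ℕ) (X : C) {Y Z : C} (g : Y ⟶ Z) : GrHom K n X Y →ₗ[K] GrHom K n X Z :=
  Submodule.mapQ _ _
    ((Linear.rightComp K X g).restrict fun f hf => ((catRadical K C).pow n).comp_mem f g hf)
    fun f hf => ((catRadical K C).pow (n + 1)).comp_mem f.1 g hf

/-- Precomposition with `g` on `rad ^ n / rad ^ (n + 1)`. -/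
def GrHom.pre (n : ℕ) {X Y : C} (g : X ⟶ Y) (Z : C) : GrHom K n Y Z →ₗ[K] GrHom K n X Z :=
  Submodule.mapQ _ _
    ((Linear.leftComp K Z g).restrict fun f hf => ((catRadical K C).pow n).mem_comp g f hf)
    fun f hf => ((catRadical K C).pow (n + 1)).mem_comp g f.1 hf

/-- The bimodule `rad / rad ^ 2`. -/
abbrev RadBimod (X Y : C) : Type v := GrHom K 1 X Y

open scoped Classical in
/-- The relations `(m ∘ d) ⊗ x = m ⊗ (d x)`. -/
def tensorRel (F : C ⥤ ModuleCat.{max u v} K) (Y : C) :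
    Submodule K (⨁ Z : C, RadBimod K Z Y ⊗[K] F.obj Z) :=
  Submodule.span K
    {t | ∃ (Z Z' : C) (d : Z ⟶ Z') (m : RadBimod K Z' Y) (x : F.obj Z),
      t = DirectSum.lof K C (fun Z => RadBimod K Z Y ⊗[K] F.obj Z) Z
            (GrHom.pre K 1 d Y m ⊗ₜ[K] x) -
          DirectSum.lof K C (fun Z => RadBimod K Z Y ⊗[K] F.obj Z) Z' (m ⊗ₜ[K] F.map d x)}

/-- The value at `Y` of the tensor product over `C` of the bimodule `rad / rad ^ 2` and the
covariant functor `F`. If `C` is Krull-Schmidt and `F` vanishes on the radical, this is the direct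
sum, over representatives `Z` of the isomorphism classes of indecomposable objects, of
`(rad / rad ^ 2) (Z, Y) ⊗ F Z`, tensored over the division ring `End Z / rad (Z, Z)`. -/
abbrev TensorObj (F : C ⥤ ModuleCat.{max u v} K) (Y : C) : Type (max u v) :=
  (⨁ Z : C, RadBimod K Z Y ⊗[K] F.obj Z) ⧸ tensorRel K F Y

open scoped Classical in
/-- The class of `m ⊗ x` in the tensor product over `C`. -/
def TensorObj.mk (F : C ⥤ ModuleCat.{max u v} K) {Z Y : C} :
    RadBimod K Z Y →ₗ[K] F.obj Z →ₗ[K] TensorObj K F Y :=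
  (TensorProduct.mk K (RadBimod K Z Y) (F.obj Z)).compr₂
    ((tensorRel K F Y).mkQ ∘ₗ DirectSum.lof K C (fun Z => RadBimod K Z Y ⊗[K] F.obj Z) Z)

theorem TensorObj.mk_pre (F : C ⥤ ModuleCat.{max u v} K) {Z Z' Y : C} (d : Z ⟶ Z')
    (m : RadBimod K Z' Y) (x : F.obj Z) :
    TensorObj.mk K F (GrHom.pre K 1 d Y m) x = TensorObj.mk K F m (F.map d x) := by
  classical
  refine (Submodule.Quotient.eq _).2 (Submodule.subset_span ⟨Z, Z', d, m, x, ?_⟩)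
  congr!

open scoped Classical in
theorem TensorObj.hom_ext {F : C ⥤ ModuleCat.{max u v} K} {Y : C} {P : Type*} [AddCommGroup P]
    [Module K P] {f g : TensorObj K F Y →ₗ[K] P}
    (h : ∀ (Z : C) (m : RadBimod K Z Y) (x : F.obj Z),
      f (TensorObj.mk K F m x) = g (TensorObj.mk K F m x)) : f = g := by
  refine Submodule.linearMap_qext _ (DirectSum.linearMap_ext _ fun Z => TensorProduct.ext' ?_)
  exact fun m x => h Z m x

open scoped Classical in
/-- Linear maps out of the tensor product over `C` are balanced families of bilinear maps. -/
def TensorObj.lift (F : C ⥤ ModuleCat.{max u v} K) (Y : C) {P : Type*} [AddCommGroup P]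
    [Module K P] (φ : ∀ Z : C, RadBimod K Z Y →ₗ[K] F.obj Z →ₗ[K] P)
    (hφ : ∀ (Z Z' : C) (d : Z ⟶ Z') (m : RadBimod K Z' Y) (x : F.obj Z),
      φ Z (GrHom.pre K 1 d Y m) x = φ Z' m (F.map d x)) : TensorObj K F Y →ₗ[K] P :=
  (tensorRel K F Y).liftQ
    (DirectSum.toModule K C P fun Z => TensorProduct.lift (φ Z)) (by
      refine Submodule.span_le.2 ?_
      rintro _ ⟨Z, Z', d, m, x, rfl⟩
      simp [hφ Z Z' d m x])

@[simp]
theorem TensorObj.lift_mk (F : C ⥤ ModuleCat.{max u v} K) (Y : C) {P : Type*} [AddCommGroup P]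
    [Module K P] (φ : ∀ Z : C, RadBimod K Z Y →ₗ[K] F.obj Z →ₗ[K] P)
    (hφ : ∀ (Z Z' : C) (d : Z ⟶ Z') (m : RadBimod K Z' Y) (x : F.obj Z),
      φ Z (GrHom.pre K 1 d Y m) x = φ Z' m (F.map d x)) {Z : C} (m : RadBimod K Z Y)
    (x : F.obj Z) : TensorObj.lift K F Y φ hφ (TensorObj.mk K F m x) = φ Z m x := by
  classical
  refine (Submodule.liftQ_apply _ _ _).trans ?_
  simp

theorem GrHom.post_pre (n : ℕ) {X Y Z W : C} (f : X ⟶ Y) (g : Z ⟶ W) (m : GrHom K n Y Z) :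
    GrHom.post K n X g (GrHom.pre K n f Z m) = GrHom.pre K n f W (GrHom.post K n Y g m) := by
  induction m using Submodule.Quotient.induction_on with
  | H m =>
    refine congrArg (Submodule.Quotient.mk) (Subtype.ext ?_)
    exact Category.assoc _ _ _

theorem GrHom.post_id (n : ℕ) {X Y : C} (m : GrHom K n X Y) :
    GrHom.post K n X (𝟙 Y) m = m := by
  induction m using Submodule.Quotient.induction_on with
  | H m =>
    refine congrArg (Submodule.Quotient.mk) (Subtype.ext ?_)
    exact Category.comp_id _

theorem GrHom.post_comp (n : ℕ) {X Y Z W : C} (f : Y ⟶ Z) (g : Z ⟶ W) (m : GrHom K n X Y) :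
    GrHom.post K n X (f ≫ g) m = GrHom.post K n X g (GrHom.post K n X f m) := by
  induction m using Submodule.Quotient.induction_on with
  | H m =>
    refine congrArg (Submodule.Quotient.mk) (Subtype.ext ?_)
    exact (Category.assoc _ _ _).symm

theorem GrHom.post_add (n : ℕ) {X Y Z : C} (f g : Y ⟶ Z) (m : GrHom K n X Y) :
    GrHom.post K n X (f + g) m = GrHom.post K n X f m + GrHom.post K n X g m := by
  induction m using Submodule.Quotient.induction_on with
  | H m =>
    refine congrArg (Submodule.Quotient.mk) (Subtype.ext ?_)
    exact Preadditive.comp_add _ _ _ _ _ _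

theorem GrHom.post_smul (n : ℕ) {X Y Z : C} (c : K) (f : Y ⟶ Z) (m : GrHom K n X Y) :
    GrHom.post K n X (c • f) m = c • GrHom.post K n X f m := by
  induction m using Submodule.Quotient.induction_on with
  | H m =>
    refine congrArg (Submodule.Quotient.mk) (Subtype.ext ?_)
    exact Linear.comp_smul _ _ _ _ _ _

theorem GrHom.post_rad (n : ℕ) {X Y Z : C} (f : Y ⟶ Z) (hf : f ∈ (catRadical K C).carrier Y Z)
    (m : GrHom K n X Y) : GrHom.post K n X f m = 0 := by
  induction m using Submodule.Quotient.induction_on with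
  | H m =>
    refine (Submodule.Quotient.mk_eq_zero _).2 ?_
    change m.1 ≫ f ∈ ((catRadical K C).pow (n + 1)).carrier X Z
    cases n with
    | zero => exact (catRadical K C).mem_comp _ _ hf
    | succ n => exact Submodule.subset_span ⟨Y, m.1, f, m.2, hf, rfl⟩

theorem TensorObj.induction {F : C ⥤ ModuleCat.{max u v} K} {Y : C} {P : TensorObj K F Y → Prop}
    (zero : P 0) (add : ∀ s t, P s → P t → P (s + t))
    (mk : ∀ (Z : C) (m : RadBimod K Z Y) (x : F.obj Z), P (TensorObj.mk K F m x))
    (t : TensorObj K F Y) : P t := by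
  classical
  obtain ⟨t, rfl⟩ := Submodule.Quotient.mk_surjective _ t
  induction t using DirectSum.induction_on with
  | zero => exact zero
  | add s t hs ht => exact add _ _ hs ht
  | of Z t =>
    induction t using TensorProduct.induction_on with
    | zero =>
      convert zero
      simp
    | add s t hs ht =>
      convert add _ _ hs ht
      simp
    | tmul m x =>
      convert mk Z m x
      refine congrArg Submodule.Quotient.mk ?_
      exact (DirectSum.lof_eq_of K _ _ _ _).symm.trans (by congr!)

/-- The map `m ⊗ x ↦ (g ∘ m) ⊗ x`. -/
def TensorObj.post (F : C ⥤ ModuleCat.{max u v} K) {Y Y' : C} (g : Y ⟶ Y') :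
    TensorObj K F Y →ₗ[K] TensorObj K F Y' :=
  TensorObj.lift K F Y (fun Z => (TensorObj.mk K F (Z := Z) (Y := Y')) ∘ₗ GrHom.post K 1 Z g)
    (fun Z Z' d m x => by simp [GrHom.post_pre, TensorObj.mk_pre])

@[simp]
theorem TensorObj.post_mk (F : C ⥤ ModuleCat.{max u v} K) {X Y Y' : C} (g : Y ⟶ Y')
    (m : RadBimod K X Y) (x : F.obj X) :
    TensorObj.post K F g (TensorObj.mk K F m x) = TensorObj.mk K F (GrHom.post K 1 X g m) x :=
  TensorObj.lift_mk K F Y _ (fun Z Z' d m x => by simp [GrHom.post_pre, TensorObj.mk_pre]) m x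

/-- The map `m ⊗ x ↦ m ⊗ η x`. -/
def TensorObj.map {F G : C ⥤ ModuleCat.{max u v} K} (η : F ⟶ G) (Y : C) :
    TensorObj K F Y →ₗ[K] TensorObj K G Y :=
  TensorObj.lift K F Y (fun Z => (TensorObj.mk K G (Z := Z) (Y := Y)).compl₂ (η.app Z).hom)
    (fun _ _ d m x => (TensorObj.mk_pre K G d m _).trans
      (congrArg _ (NatTrans.naturality_apply η d x).symm))

@[simp]
theorem TensorObj.map_mk {F G : C ⥤ ModuleCat.{max u v} K} (η : F ⟶ G) {X Y : C}
    (m : RadBimod K X Y) (x : F.obj X) :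
    TensorObj.map K η Y (TensorObj.mk K F m x) = TensorObj.mk K G m (η.app X x) :=
  TensorObj.lift_mk K F Y _ (fun _ _ d m x => (TensorObj.mk_pre K G d m _).trans
      (congrArg _ (NatTrans.naturality_apply η d x).symm)) m x

/-- The tensor product over `C` of the bimodule `rad / rad ^ 2` and a covariant functor. -/
def tensorFunctor (F : C ⥤ ModuleCat.{max u v} K) : C ⥤ ModuleCat.{max u v} K where
  obj Y := ModuleCat.of K (TensorObj K F Y)
  map g := ModuleCat.ofHom (TensorObj.post K F g)
  map_id Y := by
    ext1
    refine TensorObj.hom_ext K fun Z m x => ?_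
    simp [GrHom.post_id]
  map_comp f g := by
    ext1
    refine TensorObj.hom_ext K fun Z m x => ?_
    simp [GrHom.post_comp]

/-- Functoriality of the tensor product in the covariant functor. -/
def tensorMap {F G : C ⥤ ModuleCat.{max u v} K} (η : F ⟶ G) :
    tensorFunctor K F ⟶ tensorFunctor K G where
  app Y := ModuleCat.ofHom (TensorObj.map K η Y)
  naturality Y Y' g := by
    ext1
    refine TensorObj.hom_ext K fun Z m x => ?_
    change TensorObj.map K η Y' (TensorObj.post K F g (TensorObj.mk K F m x)) =
      TensorObj.post K G g (TensorObj.map K η Y (TensorObj.mk K F m x))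
    simp

/-- The functor `Hom (X, -) / rad (X, -)`. -/
def topFunctor (X : C) : C ⥤ ModuleCat.{max u v} K where
  obj Y := ModuleCat.of K (ULift.{u} ((X ⟶ Y) ⧸ (catRadical K C).carrier X Y))
  map {Y Y'} g := ModuleCat.ofHom <|
    ULift.moduleEquiv.symm.toLinearMap ∘ₗ
      Submodule.mapQ _ _ (Linear.rightComp K X g)
        (fun f hf => (catRadical K C).comp_mem f g hf) ∘ₗ
      ULift.moduleEquiv.toLinearMap
  map_id Y := by
    ext1
    refine LinearMap.ext fun ⟨x⟩ => ?_
    induction x using Submodule.Quotient.induction_on with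
    | H x => exact congrArg (fun t => ULift.up (Submodule.Quotient.mk t)) (Category.comp_id x)
  map_comp f g := by
    ext1
    refine LinearMap.ext fun ⟨x⟩ => ?_
    induction x using Submodule.Quotient.induction_on with
    | H x => exact congrArg (fun t => ULift.up (Submodule.Quotient.mk t)) (Category.assoc _ _ _).symm

/-- `tensorPower K X n` is the covariant functor `(rad / rad ^ 2)^{⊗ n} (X, -)`, the `n`-fold
tensor product over `C`; for `n = 0` it is `Hom (X, -) / rad (X, -)`. -/
def tensorPower (X : C) : ℕ → (C ⥤ ModuleCat.{max u v} K)
  | 0 => topFunctor K X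
  | n + 1 => tensorFunctor K (tensorPower X n)

/-- The class of `m ⊗ t`. -/
abbrev tensorPower.mk {X Y Z : C} (n : ℕ) :
    RadBimod K Y Z →ₗ[K] (tensorPower K X n).obj Y →ₗ[K] (tensorPower K X (n + 1)).obj Z :=
  TensorObj.mk K (tensorPower K X n)

/-- The class in `Hom (X, Y) / rad (X, Y)` of a morphism. -/
def tensorPower.of {X Y : C} : (X ⟶ Y) →ₗ[K] (tensorPower K X 0).obj Y :=
  ULift.moduleEquiv.symm.toLinearMap ∘ₗ ((catRadical K C).carrier X Y).mkQ

theorem tensorPower.of_surjective {X Y : C} (t : (tensorPower K X 0).obj Y) :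
    ∃ f : X ⟶ Y, t = tensorPower.of K f := by
  obtain ⟨f, hf⟩ := Submodule.Quotient.mk_surjective _ (ULift.down t)
  exact ⟨f, congrArg ULift.up hf.symm⟩

theorem tensorPower.map_of {X Y Z : C} (f : X ⟶ Y) (g : Y ⟶ Z) :
    (tensorPower K X 0).map g (tensorPower.of K f) = tensorPower.of K (f ≫ g) := rfl

theorem tensorPower.map_mk {X Y Z W : C} (n : ℕ) (m : RadBimod K Y Z)
    (t : (tensorPower K X n).obj Y) (g : Z ⟶ W) :
    (tensorPower K X (n + 1)).map g (tensorPower.mk K n m t) =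
      tensorPower.mk K n (GrHom.post K 1 Y g m) t :=
  TensorObj.post_mk K _ g m t

theorem tensorPower.hom_ext {X Y : C} {n : ℕ} {P : Type*} [AddCommGroup P] [Module K P]
    {f g : (tensorPower K X (n + 1)).obj Y →ₗ[K] P}
    (h : ∀ (Z : C) (m : RadBimod K Z Y) (t : (tensorPower K X n).obj Z),
      f (tensorPower.mk K n m t) = g (tensorPower.mk K n m t)) : f = g :=
  TensorObj.hom_ext K h

/-- The action of morphisms on the tensor powers, as a linear map in the morphism. -/
def tensorPower.mapLinear (X : C) (n : ℕ) {Y : C} (Z : C) :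
    (tensorPower K X n).obj Y →ₗ[K] (Y ⟶ Z) →ₗ[K] (tensorPower K X n).obj Z :=
  LinearMap.mk₂ K (fun t g => (tensorPower K X n).map g t)
    (fun t t' g => map_add _ t t')
    (fun c t g => map_smul _ c t)
    (fun t g g' => by
      cases n with
      | zero =>
        obtain ⟨f, rfl⟩ := tensorPower.of_surjective K t
        simp only [tensorPower.map_of, ← map_add, Preadditive.comp_add]
      | succ n =>
        have : ((tensorPower K X (n + 1)).map (g + g')).hom =
            ((tensorPower K X (n + 1)).map g).hom + ((tensorPower K X (n + 1)).map g').hom := by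
          refine tensorPower.hom_ext K fun W m s => ?_
          have h := fun g : Y ⟶ Z => tensorPower.map_mk K n m s g
          refine (h _).trans ((congrArg₂ (· + ·) (h g) (h g')).trans ?_).symm
          simp [GrHom.post_add]
        exact LinearMap.congr_fun this t)
    (fun c t g => by
      cases n with
      | zero =>
        obtain ⟨f, rfl⟩ := tensorPower.of_surjective K t
        simp only [tensorPower.map_of, ← map_smul, Linear.comp_smul]
      | succ n =>
        have : ((tensorPower K X (n + 1)).map (c • g)).hom =
            c • ((tensorPower K X (n + 1)).map g).hom := by
          refine tensorPower.hom_ext K fun W m s => ?_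
          have h := fun g : Y ⟶ Z => tensorPower.map_mk K n m s g
          refine (h _).trans ((congrArg (c • ·) (h g)).trans ?_).symm
          simp [GrHom.post_smul]
        exact LinearMap.congr_fun this t)

theorem tensorPower.map_rad (X : C) (n : ℕ) {Y Z : C} (t : (tensorPower K X n).obj Y)
    (g : Y ⟶ Z) (hg : g ∈ (catRadical K C).carrier Y Z) : (tensorPower K X n).map g t = 0 := by
  cases n with
  | zero =>
    obtain ⟨f, rfl⟩ := tensorPower.of_surjective K t
    rw [tensorPower.map_of]
    have : Submodule.Quotient.mk (f ≫ g) = (0 : _ ⧸ (catRadical K C).carrier X Z) :=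
      (Submodule.Quotient.mk_eq_zero _).2 ((catRadical K C).mem_comp f g hg)
    exact congrArg ULift.up this
  | succ n =>
    have : ((tensorPower K X (n + 1)).map g).hom = 0 := by
      refine tensorPower.hom_ext K fun W m s => ?_
      refine (tensorPower.map_mk K n m s g).trans ?_
      simp [GrHom.post_rad K 1 g hg]
    exact LinearMap.congr_fun this t

/-- An element `t` of `(rad / rad ^ 2)^{⊗ n} (X, Y)` gives the natural transformation
`s ↦ s ⊗ t` from `(rad / rad ^ 2)^{⊗ m} (Y, -)` to `(rad / rad ^ 2)^{⊗ (n + m)} (X, -)`. -/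
def tensorPower.mulRight {X Y : C} (n : ℕ) (t : (tensorPower K X n).obj Y) :
    ∀ m : ℕ, tensorPower K Y m ⟶ tensorPower K X (n + m)
  | 0 =>
    { app := fun Z => ModuleCat.ofHom <|
        (Submodule.liftQ _ (tensorPower.mapLinear K X n Z t)
          (fun g hg => tensorPower.map_rad K X n t g hg)) ∘ₗ ULift.moduleEquiv.toLinearMap
      naturality := fun Z Z' g => by
        ext1
        refine LinearMap.ext fun s => ?_
        obtain ⟨f, rfl⟩ := tensorPower.of_surjective K s
        change (tensorPower K X n).map (f ≫ g) t =
          (tensorPower K X n).map g ((tensorPower K X n).map f t)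
        simp }
  | m + 1 => tensorMap K (tensorPower.mulRight n t m)

theorem tensorPower.mulRight_of {X Y Z : C} (n : ℕ) (t : (tensorPower K X n).obj Y) (f : Y ⟶ Z) :
    (tensorPower.mulRight K n t 0).app Z (tensorPower.of K f) = (tensorPower K X n).map f t := rfl

theorem tensorPower.mulRight_mk {X Y Z W : C} (n : ℕ) (t : (tensorPower K X n).obj Y) (m : ℕ)
    (a : RadBimod K Z W) (s : (tensorPower K Y m).obj Z) :
    (tensorPower.mulRight K n t (m + 1)).app W (tensorPower.mk K m a s) =
      tensorPower.mk K (n + m) a ((tensorPower.mulRight K n t m).app Z s) :=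
  TensorObj.map_mk K _ a s

/-- The composition `(t, s) ↦ s ⊗ t` of homogeneous morphisms of the free tensor category. -/
def tensorPower.mul (X Y Z : C) (n m : ℕ) :
    (tensorPower K X n).obj Y →ₗ[K] (tensorPower K Y m).obj Z →ₗ[K]
      (tensorPower K X (n + m)).obj Z :=
  LinearMap.mk₂ K (fun t s => (tensorPower.mulRight K n t m).app Z s)
    (fun t t' s => by
      induction m generalizing Z with
      | zero =>
        obtain ⟨f, rfl⟩ := tensorPower.of_surjective K s
        simp only [tensorPower.mulRight_of]
        exact map_add _ t t'
      | succ m ih =>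
        have : ((tensorPower.mulRight K n (t + t') (m + 1)).app Z).hom =
            ((tensorPower.mulRight K n t (m + 1)).app Z).hom +
              ((tensorPower.mulRight K n t' (m + 1)).app Z).hom := by
          refine tensorPower.hom_ext K fun W a r => ?_
          refine (tensorPower.mulRight_mk K n _ m a r).trans (Eq.symm ?_)
          refine (congrArg₂ (· + ·) (tensorPower.mulRight_mk K n t m a r)
            (tensorPower.mulRight_mk K n t' m a r)).trans ?_
          rw [ih, map_add]
        exact LinearMap.congr_fun this s)
    (fun c t s => by
      induction m generalizing Z with
      | zero =>
        obtain ⟨f, rfl⟩ := tensorPower.of_surjective K s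
        simp only [tensorPower.mulRight_of]
        exact map_smul _ c t
      | succ m ih =>
        have : ((tensorPower.mulRight K n (c • t) (m + 1)).app Z).hom =
            c • ((tensorPower.mulRight K n t (m + 1)).app Z).hom := by
          refine tensorPower.hom_ext K fun W a r => ?_
          refine (tensorPower.mulRight_mk K n _ m a r).trans (Eq.symm ?_)
          refine (congrArg (c • ·) (tensorPower.mulRight_mk K n t m a r)).trans ?_
          rw [ih, map_smul]
        exact LinearMap.congr_fun this s)
    (fun t s s' => map_add _ s s')
    (fun c t s => map_smul _ c s)

end Tensor

/-! ## The free tensor category -/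

noncomputable section FreeTensor

variable (K : Type k) [Field K] {C : Type u} [Category.{v} C] [Preadditive C] [Linear K C]

/-- The morphisms of the free tensor category: `⨁ n, (rad / rad ^ 2)^{⊗ n} (X, Y)`. -/
abbrev FreeTensorHom (X Y : C) : Type (max u v) :=
  ⨁ n : ℕ, (tensorPower K X n).obj Y

namespace FreeTensorHom

/-- The inclusion of the degree `n` part. -/
abbrev incl {X Y : C} (n : ℕ) : (tensorPower K X n).obj Y →ₗ[K] FreeTensorHom K X Y :=
  DirectSum.lof K ℕ (fun n => (tensorPower K X n).obj Y) n

/-- The composition (in diagrammatic order) of the free tensor category; on homogeneous elements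
it is `(t, s) ↦ s ⊗ t`. -/
def comp (X Y Z : C) :
    FreeTensorHom K X Y →ₗ[K] FreeTensorHom K Y Z →ₗ[K] FreeTensorHom K X Z :=
  DirectSum.toModule K ℕ _ fun n => LinearMap.flip <|
    DirectSum.toModule K ℕ _ fun m => LinearMap.flip <|
      (tensorPower.mul K X Y Z n m).compr₂ (incl K (n + m))

theorem comp_incl {X Y Z : C} (n m : ℕ) (t : (tensorPower K X n).obj Y)
    (s : (tensorPower K Y m).obj Z) :
    comp K X Y Z (incl K n t) (incl K m s) = incl K (n + m) (tensorPower.mul K X Y Z n m t s) := by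
  simp [comp]

/-- The map `s ↦ a ⊗ s`. -/
def cons {X Y Z : C} (a : RadBimod K Y Z) : FreeTensorHom K X Y →ₗ[K] FreeTensorHom K X Z :=
  DirectSum.toModule K ℕ _ fun n => incl K (n + 1) ∘ₗ tensorPower.mk K n a

/-- Postcomposition with a morphism of `C`. -/
def post (X : C) {Y Z : C} (f : Y ⟶ Z) : FreeTensorHom K X Y →ₗ[K] FreeTensorHom K X Z :=
  DirectSum.toModule K ℕ _ fun n => incl K n ∘ₗ ((tensorPower K X n).map f).hom

@[simp]
theorem cons_incl {X Y Z : C} (a : RadBimod K Y Z) (n : ℕ) (s : (tensorPower K X n).obj Y) :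
    cons K a (incl K n s) = incl K (n + 1) (tensorPower.mk K n a s) := by
  simp [cons]

@[simp]
theorem post_incl {X Y Z : C} (f : Y ⟶ Z) (n : ℕ) (s : (tensorPower K X n).obj Y) :
    post K X f (incl K n s) = incl K n ((tensorPower K X n).map f s) := by
  simp [post]

/-- The morphism of degree `0` given by a morphism of `C`. -/
abbrev ofHom {X Y : C} (f : X ⟶ Y) : FreeTensorHom K X Y := incl K 0 (tensorPower.of K f)

@[elab_as_elim]
theorem induction {X : C} {P : ∀ {Y : C}, FreeTensorHom K X Y → Prop}
    (zero : ∀ Y : C, P (0 : FreeTensorHom K X Y))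
    (add : ∀ {Y : C} (s t : FreeTensorHom K X Y), P s → P t → P (s + t))
    (of : ∀ {Y : C} (f : X ⟶ Y), P (ofHom K f))
    (cons : ∀ {Y Z : C} (a : RadBimod K Y Z) (s : FreeTensorHom K X Y), P s → P (cons K a s))
    {Y : C} (s : FreeTensorHom K X Y) : P s := by
  induction s using DirectSum.induction_on with
  | zero => exact zero Y
  | add s t hs ht => exact add s t hs ht
  | of n t =>
    change P (incl K n t)
    induction n generalizing Y with
    | zero =>
      obtain ⟨f, rfl⟩ := tensorPower.of_surjective K t
      exact of f
    | succ n ih =>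
      induction t using TensorObj.induction with
      | zero => exact (map_zero (incl K (X := X) (Y := Y) (n + 1))).symm ▸ zero Y
      | add s t hs ht => exact (map_add (incl K (X := X) (Y := Y) (n + 1)) s t).symm ▸ add _ _ hs ht
      | mk Z a s =>
        have := cons a (incl K n s) (ih s)
        rwa [cons_incl] at this

theorem comp_ofHom {X Y Z : C} (t : FreeTensorHom K X Y) (f : Y ⟶ Z) :
    comp K X Y Z t (ofHom K f) = post K X f t := by
  induction t using DirectSum.induction_on with
  | zero => simp
  | add s t hs ht => simp only [map_add, LinearMap.add_apply, hs, ht]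
  | of n t =>
    change comp K X Y Z (incl K n t) _ = post K X f (incl K n t)
    rw [comp_incl, post_incl]
    rfl

theorem comp_cons {X Y Z W : C} (t : FreeTensorHom K X Y) (a : RadBimod K Z W)
    (s : FreeTensorHom K Y Z) :
    comp K X Y W t (cons K a s) = cons K a (comp K X Y Z t s) := by
  induction t using DirectSum.induction_on with
  | zero => simp
  | add t t' ht ht' => simp only [map_add, LinearMap.add_apply, ht, ht']
  | of n t =>
    induction s using DirectSum.induction_on with
    | zero => simp
    | add s s' hs hs' => simp only [map_add, hs, hs']
    | of m s =>
      change comp K X Y W (incl K n t) (cons K a (incl K m s)) =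
        cons K a (comp K X Y Z (incl K n t) (incl K m s))
      rw [cons_incl, comp_incl, comp_incl, cons_incl]
      exact congrArg _ (tensorPower.mulRight_mk K n t m a s)

theorem comp_post {X Y Z W : C} (t : FreeTensorHom K X Y) (f : Z ⟶ W)
    (s : FreeTensorHom K Y Z) :
    comp K X Y W t (post K Y f s) = post K X f (comp K X Y Z t s) := by
  induction t using DirectSum.induction_on with
  | zero => simp
  | add t t' ht ht' => simp only [map_add, LinearMap.add_apply, ht, ht']
  | of n t =>
    induction s using DirectSum.induction_on with
    | zero => simp
    | add s s' hs hs' => simp only [map_add, hs, hs']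
    | of m s =>
      change comp K X Y W (incl K n t) (post K Y f (incl K m s)) =
        post K X f (comp K X Y Z (incl K n t) (incl K m s))
      rw [post_incl, comp_incl, comp_incl, post_incl]
      exact congrArg _ (NatTrans.naturality_apply (tensorPower.mulRight K n t m) f s)

theorem comp_assoc {X Y Z W : C} (a : FreeTensorHom K X Y) (b : FreeTensorHom K Y Z)
    (c : FreeTensorHom K Z W) :
    comp K X Z W (comp K X Y Z a b) c = comp K X Y W a (comp K Y Z W b c) := by
  induction c using FreeTensorHom.induction with
  | zero => simp
  | add s t hs ht => simp only [map_add, hs, ht]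
  | of f => rw [comp_ofHom, comp_ofHom, comp_post]
  | cons m s hs => rw [comp_cons, comp_cons, comp_cons, hs]

theorem comp_one {X Y : C} (a : FreeTensorHom K X Y) : comp K X Y Y a (ofHom K (𝟙 Y)) = a := by
  rw [comp_ofHom]
  induction a using DirectSum.induction_on with
  | zero => simp
  | add s t hs ht => simp only [map_add, hs, ht]
  | of n t =>
    change post K X (𝟙 Y) (incl K n t) = incl K n t
    simp

theorem one_comp {X Y : C} (a : FreeTensorHom K X Y) : comp K X X Y (ofHom K (𝟙 X)) a = a := by
  induction a using FreeTensorHom.induction with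
  | zero => simp
  | add s t hs ht => simp only [map_add, hs, ht]
  | of f =>
    rw [comp_ofHom, post_incl, tensorPower.map_of, Category.id_comp]
  | cons m s hs => rw [comp_cons, hs]

end FreeTensorHom

/-- The free tensor category `T(C)` of `C` over the bimodule `rad / rad ^ 2`. It has the same
objects as `C`. -/
structure FreeTensorCat (K : Type k) (C : Type u) : Type u where
  /-- The object of `C` underlying an object of `T(C)`. -/
  base : C

namespace FreeTensorCat

instance : Category.{max u v} (FreeTensorCat K C) where
  Hom X Y := FreeTensorHom K X.base Y.base
  id X := FreeTensorHom.ofHom K (𝟙 X.base)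
  comp f g := FreeTensorHom.comp K _ _ _ f g
  id_comp f := FreeTensorHom.one_comp K f
  comp_id f := FreeTensorHom.comp_one K f
  assoc f g h := FreeTensorHom.comp_assoc K f g h

instance : Preadditive (FreeTensorCat K C) where
  homGroup X Y := inferInstanceAs (AddCommGroup (FreeTensorHom K X.base Y.base))
  add_comp X Y Z f g h :=
    (FreeTensorHom.comp K X.base Y.base Z.base).map_add₂ f g h
  comp_add X Y Z f g h := (FreeTensorHom.comp K X.base Y.base Z.base f).map_add g h

instance : Linear K (FreeTensorCat K C) where
  homModule X Y := inferInstanceAs (Module K (FreeTensorHom K X.base Y.base))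
  smul_comp X Y Z c f g :=
    (FreeTensorHom.comp K X.base Y.base Z.base).map_smul₂ c f g
  comp_smul X Y Z f c g := (FreeTensorHom.comp K X.base Y.base Z.base f).map_smul c g

/-- The morphisms of degree `i` of the free tensor category: the elements of tensor degree `i`
(there are none but zero if `i < 0`). -/
def degSubmodule (X Y : C) (i : ℤ) : Submodule K (FreeTensorHom K X Y) where
  carrier := {f | ∀ n : ℕ, (n : ℤ) ≠ i → f n = 0}
  zero_mem' := fun _ _ => rfl
  add_mem' := fun {f g} hf hg n hn => by
    change f n + g n = 0
    rw [hf n hn, hg n hn, add_zero]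
  smul_mem' := fun c f hf n hn => by
    change c • (f n) = 0
    rw [hf n hn, smul_zero]

theorem incl_mem {X Y : C} (n : ℕ) (t : (tensorPower K X n).obj Y) :
    FreeTensorHom.incl K n t ∈ degSubmodule K X Y n := fun m hm => by
  rw [DirectSum.lof_eq_of]
  exact DirectSum.of_eq_of_ne _ _ _ (by exact_mod_cast hm)

theorem eq_incl_of_mem {X Y : C} (n : ℕ) (f : FreeTensorHom K X Y)
    (hf : f ∈ degSubmodule K X Y n) : f = FreeTensorHom.incl K n (f n) := by
  refine DFinsupp.ext fun m => ?_
  by_cases h : m = n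
  · subst h
    exact (DirectSum.lof_apply (M := fun n => (tensorPower K X n).obj Y) K m (f m)).symm
  · have h' : (m : ℤ) ≠ n := by exact_mod_cast h
    rw [hf m h']
    exact (incl_mem K n (f n) m h').symm

theorem eq_zero_of_mem {X Y : C} {i : ℤ} (hi : i < 0) (f : FreeTensorHom K X Y)
    (hf : f ∈ degSubmodule K X Y i) : f = 0 :=
  DFinsupp.ext fun m => hf m (by omega)

theorem degSubmodule_isInternal (X Y : C) : DirectSum.IsInternal (degSubmodule K X Y) := by
  refine (DirectSum.isInternal_submodule_iff_iSupIndep_and_iSup_eq_top _).2 ⟨fun i => ?_, ?_⟩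
  · refine Submodule.disjoint_def.2 fun f hf hf' => DFinsupp.ext fun n => ?_
    by_cases hn : (n : ℤ) = i
    · have : (⨆ j, ⨆ (_ : j ≠ i), degSubmodule K X Y j) ≤
          LinearMap.ker (DirectSum.component K ℕ (fun n => (tensorPower K X n).obj Y) n) :=
        iSup₂_le fun j hj g hg => hg n (fun h => hj (h.symm.trans hn))
      exact this hf'
    · exact hf n hn
  · refine eq_top_iff.2 fun f _ => ?_
    induction f using DirectSum.induction_on with
    | zero => exact Submodule.zero_mem _
    | add f g hf hg => exact Submodule.add_mem _ (hf trivial) (hg trivial)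
    | of n t => exact Submodule.mem_iSup_of_mem (n : ℤ) (incl_mem K n t)

theorem comp_mem {X Y Z : C} {i j : ℤ} (f : FreeTensorHom K X Y) (g : FreeTensorHom K Y Z)
    (hf : f ∈ degSubmodule K X Y i) (hg : g ∈ degSubmodule K Y Z j) :
    FreeTensorHom.comp K X Y Z f g ∈ degSubmodule K X Z (i + j) := by
  rcases lt_or_ge i 0 with hi | hi
  · rw [eq_zero_of_mem K hi f hf, map_zero]
    exact Submodule.zero_mem _
  rcases lt_or_ge j 0 with hj | hj
  · rw [eq_zero_of_mem K hj g hg, map_zero]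
    exact Submodule.zero_mem _
  lift i to ℕ using hi
  lift j to ℕ using hj
  rw [eq_incl_of_mem K i f hf, eq_incl_of_mem K j g hg, FreeTensorHom.comp_incl]
  exact_mod_cast incl_mem K (i + j) _

instance : GradedCategory K (FreeTensorCat K C) where
  deg X Y i := degSubmodule K X.base Y.base i
  isInternal X Y := degSubmodule_isInternal K X.base Y.base
  id_mem X := incl_mem K 0 (tensorPower.of K (𝟙 X.base))
  comp_mem f g hf hg := comp_mem K f g hf hg

instance : IsPositivelyGraded K (FreeTensorCat K C) where
  deg_eq_bot _ _ _ hi := eq_bot_iff.2 fun f hf => eq_zero_of_mem K hi f hf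

end FreeTensorCat

end FreeTensor

/-!
Write `T` for the free tensor category and `M` for the bimodule `rad / rad ^ 2`.

Restricting a graded functor on `T` to the morphisms of degree zero gives, in each degree, a module
over `C / rad`. As `C` is Krull-Schmidt, `C / rad` is semisimple: every pointwise surjective natural
transformation of such modules has a section (`exists_section`). Restriction has a left adjoint, the
induction `G ↦ G ⊗ T`, where `⊗` is the tensor product over `C` and the elements of `G` may be
placed in any degree (`GrFunctor.ind`, `GrFunctor.indDesc`). An epimorphism of graded functors is
pointwise surjective (`GrFunctor.surjective_of_epi`), so that it splits after restriction; by
adjunction every induced functor is projective (`GrFunctor.projective_ind`).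

Since `T` is freely generated by `M` over `C / rad`, every graded functor `F` has the standard
resolution `0 ⟶ F ⊗ M ⊗ T ⟶ F ⊗ T ⟶ F ⟶ 0` by induced functors, whose first map is
`x ⊗ a ⊗ s ↦ x a ⊗ s - x ⊗ a s`. It is exact because of the contracting homotopy `r` with
`r (x ⊗ a s) = r (x a ⊗ s) - x ⊗ a ⊗ s`, which strips the factors of a tensor one at a time
(`GrFunctor.homotopy`, `GrFunctor.isShortExact_syzygy_counit`). Finally, the radical of `Hom (-, X)`
consists of the tensors of positive degree, that is, it is induced from `M (-, X)`, placed in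
degree one (`GrFunctor.projective_radRepresentable`).

Below, the elements of `F ⊗ T` are written `s ⊗ x`, where `s` is a morphism of `T` and `x` a value
of `F` at its target, and `a s` is the composite of `s` followed by `a`.
-/

/-! ### Internal gradings -/

section InternalGradings

variable {K : Type k} [Field K] {V : Type w} [AddCommGroup V] [Module K V]
  {ι : Type*} [DecidableEq ι]

/-- A family of subspaces which spans the whole space is a grading as soon as there are projections
to its members. -/
theorem isInternal_of_projections (A : ι → Submodule K V) (hsup : ⨆ i, A i = ⊤)
    (π : ι → V →ₗ[K] V) (h₁ : ∀ i, ∀ x ∈ A i, π i x = x)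
    (h₂ : ∀ i j, j ≠ i → ∀ x ∈ A j, π i x = 0) : DirectSum.IsInternal A := by
  refine (DirectSum.isInternal_submodule_iff_iSupIndep_and_iSup_eq_top _).2 ⟨fun i => ?_, hsup⟩
  refine Submodule.disjoint_def.2 fun x hx hx' => ?_
  have : (⨆ j, ⨆ (_ : j ≠ i), A j) ≤ LinearMap.ker (π i) :=
    iSup₂_le fun j hj y hy => h₂ i j hj y hy
  rw [← h₁ i x hx]
  exact this hx'

theorem DirectSum.IsInternal.exists_projections {A : ι → Submodule K V}
    (h : DirectSum.IsInternal A) : ∃ π : ι → V →ₗ[K] V, (∀ i x, π i x ∈ A i) ∧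
      (∀ i, ∀ x ∈ A i, π i x = x) ∧ ∀ i j, j ≠ i → ∀ x ∈ A j, π i x = 0 := by
  let e := LinearEquiv.ofBijective (DirectSum.coeLinearMap A) h
  have he : ∀ (j : ι) (x : A j), e.symm (x : V) = DirectSum.lof K ι (fun i => A i) j x :=
    fun j x => e.symm_apply_eq.2 (DirectSum.coeLinearMap_lof A j x).symm
  refine ⟨fun i => (A i).subtype ∘ₗ DirectSum.component K ι (fun i => A i) i ∘ₗ
    e.symm.toLinearMap, fun i x => Subtype.prop _, fun i x hx => ?_, fun i j hij x hx => ?_⟩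
  · have := he i ⟨x, hx⟩
    simp only [LinearMap.comp_apply, LinearEquiv.coe_coe, this, DirectSum.component.lof_self,
      Submodule.subtype_apply]
  · have := he j ⟨x, hx⟩
    simp only [LinearMap.comp_apply, LinearEquiv.coe_coe, this, Submodule.subtype_apply,
      DirectSum.component.of, dif_neg hij, Submodule.coe_zero]

end InternalGradings

/-! ### Epimorphisms of graded functors are surjective -/

section Epi

namespace GrFunctor

variable {K : Type k} [Field K] {D : Type u} [Category.{v} D] [Preadditive D] [Linear K D]
  [GradedCategory K D]

/-- The projection of `F X` to its elements of degree `i`. -/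
noncomputable def proj (F : GrFunctor.{k, v, u, w} K D) (X : D) (i : ℤ) :
    F.toFunctor.obj (op X) →ₗ[K] F.toFunctor.obj (op X) :=
  (F.isInternal X).exists_projections.choose i

variable (F : GrFunctor.{k, v, u, w} K D)

theorem proj_mem (X : D) (i : ℤ) (x : F.toFunctor.obj (op X)) : F.proj X i x ∈ F.deg X i :=
  (F.isInternal X).exists_projections.choose_spec.1 i x

theorem proj_of_mem {X : D} {i : ℤ} {x : F.toFunctor.obj (op X)} (hx : x ∈ F.deg X i) :
    F.proj X i x = x :=
  (F.isInternal X).exists_projections.choose_spec.2.1 i x hx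

theorem proj_of_mem_ne {X : D} {i j : ℤ} (hij : j ≠ i) {x : F.toFunctor.obj (op X)}
    (hx : x ∈ F.deg X j) : F.proj X i x = 0 :=
  (F.isInternal X).exists_projections.choose_spec.2.2 i j hij x hx

variable {F}

/-- Natural transformations of degree zero commute with the projections to the graded pieces. -/
theorem proj_app {E : GrFunctor.{k, v, u, w} K D} (η : E ⟶ F) (X : D) (i : ℤ)
    (y : E.toFunctor.obj (op X)) :
    F.proj X i (η.natTrans.app (op X) y) = η.natTrans.app (op X) (E.proj X i y) := by
  have hy : y ∈ ⨆ j, E.deg X j := (E.isInternal X).submodule_iSup_eq_top ▸ Submodule.mem_top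
  induction hy using Submodule.iSup_induction' with
  | zero => simp
  | add y z _ _ hy hz =>
    simp only [_root_.map_add, hy, hz]
  | mem j y hy =>
    by_cases hij : j = i
    · subst hij
      rw [E.proj_of_mem hy, F.proj_of_mem (η.deg_mem X j y hy)]
    · rw [E.proj_of_mem_ne hij hy, F.proj_of_mem_ne hij (η.deg_mem X j y hy), map_zero]

theorem exists_mem_deg_app_eq {E : GrFunctor.{k, v, u, w} K D} (η : E ⟶ F) {X : D}
    (hη : Function.Surjective (η.natTrans.app (op X))) (i : ℤ) (x : F.toFunctor.obj (op X))
    (hx : x ∈ F.deg X i) : ∃ y ∈ E.deg X i, η.natTrans.app (op X) y = x := by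
  obtain ⟨y, rfl⟩ := hη x
  exact ⟨E.proj X i y, E.proj_mem X i y, by rw [← proj_app, F.proj_of_mem hx]⟩

/-- The cokernel of a natural transformation of degree zero. -/
noncomputable def coker {E : GrFunctor.{k, v, u, w} K D} (η : E ⟶ F) : GrFunctor.{k, v, u, w} K D :=
  have key : ∀ {X Y : Dᵒᵖ} (f : X ⟶ Y), LinearMap.range (η.natTrans.app X).hom ≤
      (LinearMap.range (η.natTrans.app Y).hom).comap (F.toFunctor.map f).hom := by
    rintro X Y f _ ⟨y, rfl⟩
    exact ⟨E.toFunctor.map f y, NatTrans.naturality_apply η.natTrans f y⟩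
  { toFunctor :=
      { obj := fun X => ModuleCat.of K (F.toFunctor.obj X ⧸ LinearMap.range (η.natTrans.app X).hom)
        map := fun f => ModuleCat.ofHom (Submodule.mapQ _ _ (F.toFunctor.map f).hom (key f))
        map_id := fun X => ModuleCat.hom_ext <| Submodule.linearMap_qext _ <| LinearMap.ext fun x =>
          congrArg (LinearMap.range (η.natTrans.app X).hom).mkQ
            (congrArg (fun φ => φ.hom x) (F.toFunctor.map_id X))
        map_comp := fun {X Y Z} f g => ModuleCat.hom_ext <| Submodule.linearMap_qext _ <|
          LinearMap.ext fun x => congrArg (LinearMap.range (η.natTrans.app Z).hom).mkQ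
            (congrArg (fun φ => φ.hom x) (F.toFunctor.map_comp f g)) }
    map_add := fun {X Y} f g => ModuleCat.hom_ext <| Submodule.linearMap_qext _ <|
      LinearMap.ext fun x => congrArg (LinearMap.range (η.natTrans.app (op X)).hom).mkQ
        (congrArg (fun φ => φ.hom x) (F.map_add f g))
    map_smul := fun {X Y} c f => ModuleCat.hom_ext <| Submodule.linearMap_qext _ <|
      LinearMap.ext fun x => congrArg (LinearMap.range (η.natTrans.app (op X)).hom).mkQ
        (congrArg (fun φ => φ.hom x) (F.map_smul c f))
    deg := fun X j => (F.deg X j).map (LinearMap.range (η.natTrans.app (op X)).hom).mkQ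
    isInternal := fun X => by
      have hπ : ∀ i, LinearMap.range (η.natTrans.app (op X)).hom ≤
          (LinearMap.range (η.natTrans.app (op X)).hom).comap (F.proj X i) := by
        rintro i _ ⟨y, rfl⟩
        exact ⟨E.proj X i y, (proj_app η X i y).symm⟩
      refine isInternal_of_projections _ ?_ (fun i => Submodule.mapQ _ _ (F.proj X i) (hπ i)) ?_ ?_
      · rw [← Submodule.map_iSup, (F.isInternal X).submodule_iSup_eq_top, Submodule.map_top,
          Submodule.range_mkQ]
      · rintro i _ ⟨x, hx, rfl⟩
        exact congrArg Submodule.Quotient.mk (F.proj_of_mem hx)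
      · rintro i j hij _ ⟨x, hx, rfl⟩
        exact congrArg Submodule.Quotient.mk (F.proj_of_mem_ne hij hx)
    map_mem := by
      rintro X Y i j f hf _ ⟨x, hx, rfl⟩
      exact ⟨_, F.map_mem f hf x hx, rfl⟩ }

/-- An epimorphism equalizes the projection to its cokernel and the zero map. -/
theorem surjective_of_epi {E : GrFunctor.{k, v, u, w} K D} (η : E ⟶ F) [Epi η] (X : D) :
    Function.Surjective (η.natTrans.app (op X)) := by
  let q : F ⟶ coker η :=
    { natTrans := { app := fun X => ModuleCat.ofHom (Submodule.mkQ _) }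
      deg_mem := fun X i x hx => ⟨x, hx, rfl⟩ }
  let z : F ⟶ coker η := { natTrans := 0, deg_mem := fun X i x hx => Submodule.zero_mem _ }
  have hqz : q = z := by
    refine (cancel_epi η).1 (Hom.ext (NatTrans.ext (funext fun Y => ?_)))
    ext y
    exact (Submodule.Quotient.mk_eq_zero _).2 ⟨y, rfl⟩
  intro x
  have : (Submodule.Quotient.mk x : _ ⧸ LinearMap.range (η.natTrans.app (op X)).hom) = 0 :=
    congrArg (fun φ : F ⟶ coker η => φ.natTrans.app (op X) x) hqz
  exact (Submodule.Quotient.mk_eq_zero _).1 this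

end GrFunctor

end Epi

/-! ### Modules over `C / rad` are semisimple -/

section Semisimple

variable {K : Type k} [Field K] {C : Type u} [Category.{v} C] [Preadditive C] [Linear K C]

/-- A morphism to an object with local endomorphism ring is radical unless it is a split
epimorphism. -/
theorem exists_comp_eq_id_of_notMem_radical {W Z : C} [IsLocalRing (End Z)] (f : W ⟶ Z)
    (hf : f ∉ (catRadical K C).carrier W Z) : ∃ g : Z ⟶ W, g ≫ f = 𝟙 Z := by
  by_contra! hg
  refine hf fun h => (mem_ringJacobson_iff (R := End W) _).2 fun y => ?_
  -- `1 + g f` is invertible for all `g`, as `End Z` is local and `g f` is not invertible.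
  have hu : IsUnit (M := End Z) (((h ≫ y) ≫ f : Z ⟶ Z) + 𝟙 Z) := by
    refine (IsLocalRing.isUnit_or_isUnit_of_add_one (R := End Z)
      (a := -((h ≫ y) ≫ f : Z ⟶ Z)) (neg_add_cancel_left _ _)).resolve_left fun h' => ?_
    obtain ⟨u, hu⟩ := h'.exists_right_inv
    refine hg (-((show Z ⟶ Z from u) ≫ h ≫ y)) ?_
    have hu' : (show Z ⟶ Z from u) ≫ (-((h ≫ y) ≫ f)) = 𝟙 Z := hu
    simpa using hu'
  obtain ⟨z, hz⟩ := hu.exists_left_inv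
  have hz' : ((h ≫ y) ≫ f + 𝟙 Z) ≫ z = 𝟙 Z := hz
  refine ⟨𝟙 W - f ≫ z ≫ h ≫ y, ?_⟩
  -- If `1 + b a` is inverted by `z`, then `1 + a b` is inverted by `1 - a z b`.
  have h' : f ≫ (((h ≫ y) ≫ f + 𝟙 Z) ≫ z) ≫ h ≫ y = f ≫ h ≫ y := by
    rw [hz', Category.id_comp]
  change ((f ≫ h) ≫ y + 𝟙 W) ≫ (𝟙 W - f ≫ z ≫ h ≫ y) = 𝟙 W
  simp only [Preadditive.add_comp, Preadditive.comp_add, Category.assoc, Category.id_comp,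
    Category.comp_id, Preadditive.comp_sub] at h' ⊢
  rw [← h']
  abel

/-- The functor `G` is a module over the semisimple `K`-category `C / rad`. -/
structure IsRadModule (G : Cᵒᵖ ⥤ ModuleCat.{w} K) : Prop where
  map_add {X Y : C} (f g : X ⟶ Y) : G.map (f + g).op = G.map f.op + G.map g.op
  map_smul {X Y : C} (c : K) (f : X ⟶ Y) : G.map (c • f).op = c • G.map f.op
  map_rad {X Y : C} (f : X ⟶ Y) (hf : f ∈ (catRadical K C).carrier X Y) : G.map f.op = 0

theorem eq_sum_map_biproduct {F : Cᵒᵖ ⥤ ModuleCat.{w} K} [HasFiniteBiproducts C]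
    (hF : IsRadModule F) {X : C} {n : ℕ} {Y : Fin n → C} (e : X ≅ ⨁ Y)
    (x : F.obj (op X)) :
    x = ∑ i, F.map (e.hom ≫ biproduct.π Y i).op (F.map (biproduct.ι Y i ≫ e.inv).op x) := by
  let A : (X ⟶ X) →+ F.obj (op X) :=
    AddMonoidHom.mk' (fun f => F.map f.op x) fun f g => by rw [hF.map_add]; rfl
  have h1 : A (𝟙 X) = x := by simp [A]
  have h2 : 𝟙 X = ∑ i, (e.hom ≫ biproduct.π Y i) ≫ (biproduct.ι Y i ≫ e.inv) := by
    have : e.hom ≫ (∑ i, biproduct.π Y i ≫ biproduct.ι Y i) ≫ e.inv = 𝟙 X := by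
      rw [biproduct.total, Category.id_comp, e.hom_inv_id]
    rw [← this]
    simp only [Preadditive.comp_sum, Preadditive.sum_comp, Category.assoc]
  conv_lhs => rw [← h1, h2, map_sum]
  refine Finset.sum_congr rfl fun i _ => ?_
  change F.map (_ ≫ _).op x = _
  rw [op_comp, F.map_comp]
  rfl

/-- The category `C / rad` is semisimple. The image of the section is a subfunctor of `E` which is
maximal among those meeting the kernel of `η` trivially; it maps onto `F Z` for `Z` with local
endomorphism ring, hence onto `F`. -/
theorem exists_section [HasFiniteBiproducts C] (hKS : IsKrullSchmidt C)
    {E F : Cᵒᵖ ⥤ ModuleCat.{w} K} (hE : IsRadModule E) (hF : IsRadModule F) (η : E ⟶ F)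
    (hη : ∀ X, Function.Surjective (η.app X)) : ∃ s : F ⟶ E, s ≫ η = 𝟙 F := by
  -- The subfunctors of `E` which meet the kernel of `η` trivially.
  let S : Set (∀ X : Cᵒᵖ, Submodule K (E.obj X)) := {V |
    (∀ (X Y : Cᵒᵖ) (f : X ⟶ Y), ∀ x ∈ V X, E.map f x ∈ V Y) ∧
    ∀ X, ∀ x ∈ V X, η.app X x = 0 → x = 0}
  obtain ⟨V, hV⟩ : ∃ V, Maximal (· ∈ S) V := by
    refine zorn_le₀ S fun c hcS hc => ?_
    rcases c.eq_empty_or_nonempty with rfl | hne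
    · refine ⟨⊥, ⟨fun X Y f x hx => ?_, fun X x hx _ => ?_⟩, by simp⟩
      · rw [(Submodule.mem_bot K).1 hx, map_zero]
        exact Submodule.zero_mem _
      · exact (Submodule.mem_bot K).1 hx
    have : Nonempty c := hne.to_subtype
    have hmem : ∀ X x, x ∈ (⨆ V : c, V.1 X) ↔ ∃ V : c, x ∈ V.1 X := fun X x =>
      Submodule.mem_iSup_of_directed _ fun V W =>
        (hc.total V.2 W.2).elim (fun h => ⟨W, h X, le_rfl⟩) fun h => ⟨V, le_rfl, h X⟩
    refine ⟨fun X => ⨆ V : c, V.1 X, ⟨fun X Y f x hx => ?_, fun X x hx h0 => ?_⟩,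
      fun V hV X => le_iSup (fun V : c => V.1 X) ⟨V, hV⟩⟩
    · obtain ⟨V, hx⟩ := (hmem X x).1 hx
      exact (hmem Y _).2 ⟨V, (hcS V.2).1 X Y f x hx⟩
    · obtain ⟨V, hx⟩ := (hmem X x).1 hx
      exact (hcS V.2).2 X x hx h0
  obtain ⟨hst, hker⟩ := hV.prop
  have hloc : ∀ (Z : C), IsLocalRing (End Z) → ∀ x : F.obj (op Z), ∃ v ∈ V (op Z),
      η.app (op Z) v = x := by
    intro Z _ x
    by_contra hx
    -- Otherwise `V` could be enlarged by the subfunctor generated by a preimage `y` of `x`.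
    obtain ⟨y, hy⟩ := hη (op Z) x
    let a : ∀ X : Cᵒᵖ, (X.unop ⟶ Z) →ₗ[K] E.obj X := fun X =>
      { toFun := fun f => E.map f.op y
        map_add' := fun f g => by rw [hE.map_add]; rfl
        map_smul' := fun c f => by rw [hE.map_smul]; rfl }
    have hmem : (fun X => V X ⊔ LinearMap.range (a X)) ∈ S := by
      refine ⟨fun X Y f x hx => ?_, fun X x' hx' h0 => ?_⟩
      · obtain ⟨v, hv, _, ⟨g, rfl⟩, rfl⟩ := Submodule.mem_sup.1 hx
        rw [map_add]
        refine Submodule.add_mem_sup (hst X Y f v hv) ⟨f.unop ≫ g, ?_⟩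
        change E.map (f.unop ≫ g).op y = E.map f (E.map g.op y)
        rw [op_comp, E.map_comp]
        rfl
      · obtain ⟨v, hv, _, ⟨f, rfl⟩, rfl⟩ := Submodule.mem_sup.1 hx'
        -- If `f` is not in the radical, it is a split epimorphism, so that `x` lies in
        -- the image of `V`.
        have hf : f ∈ (catRadical K C).carrier X.unop Z := by
          by_contra hf
          obtain ⟨g, hg⟩ := exists_comp_eq_id_of_notMem_radical f hf
          refine hx ⟨-(E.map g.op v), Submodule.neg_mem _ (hst X (op Z) _ v hv), ?_⟩
          have h1 : F.map g.op (η.app X (v + E.map f.op y)) = 0 := by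
            have h0' : η.app X (v + E.map f.op y) = 0 := h0
            rw [h0', map_zero]
          have h2 : F.map g.op (F.map f.op x) = x := by
            have : F.map (g ≫ f).op x = x := by
              rw [hg, op_id, F.map_id]
              rfl
            rwa [op_comp, F.map_comp] at this
          rw [map_add, map_add, NatTrans.naturality_apply η f.op y, hy, h2] at h1
          rw [map_neg, NatTrans.naturality_apply η _ v]
          exact neg_eq_of_add_eq_zero_right h1
        have h0' : a X f = 0 := by
          change E.map f.op y = 0
          rw [hE.map_rad f hf]; rfl
        rw [h0', add_zero] at h0 ⊢
        exact hker X v hv h0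
    have hle := hV.le_of_ge hmem (fun X => le_sup_left) (op Z)
    refine hx ⟨y, hle (Submodule.mem_sup_right ⟨𝟙 Z, ?_⟩), hy⟩
    change E.map (𝟙 (op Z)) y = y
    simp
  have hsurj : ∀ (X : Cᵒᵖ) (x : F.obj X), ∃ v ∈ V X, η.app X v = x := by
    intro X x
    obtain ⟨n, Y, hY, ⟨e⟩⟩ := hKS X.unop
    choose v hv hvx using fun i => hloc (Y i) (hY i) (F.map (biproduct.ι Y i ≫ e.inv).op x)
    refine ⟨∑ i, E.map (e.hom ≫ biproduct.π Y i).op (v i),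
      Submodule.sum_mem _ fun i _ => hst _ _ _ _ (hv i), ?_⟩
    rw [map_sum]
    conv_rhs => rw [eq_sum_map_biproduct hF e x]
    refine Finset.sum_congr rfl fun i _ => ?_
    rw [NatTrans.naturality_apply η, hvx]
  let b : ∀ X, V X ≃ₗ[K] F.obj X := fun X =>
    LinearEquiv.ofBijective ((η.app X).hom ∘ₗ (V X).subtype)
      ⟨(injective_iff_map_eq_zero _).2 fun x hx => Subtype.ext (hker X x.1 x.2 hx),
        fun x => let ⟨v, hv, h⟩ := hsurj X x; ⟨⟨v, hv⟩, h⟩⟩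
  have hb : ∀ X x, η.app X ((b X).symm x : E.obj X) = x := fun X x => (b X).apply_symm_apply x
  refine ⟨{ app := fun X => ModuleCat.ofHom ((V X).subtype ∘ₗ (b X).symm.toLinearMap)
            naturality := fun X Y f => ?_ }, ?_⟩
  · ext x
    change ((b Y).symm (F.map f x) : E.obj Y) = E.map f ((b X).symm x : E.obj X)
    refine congrArg Subtype.val (a₂ := ⟨_, hst X Y f _ ((b X).symm x).2⟩) ?_
    rw [LinearEquiv.symm_apply_eq]
    change F.map f x = η.app Y (E.map f ((b X).symm x : E.obj X))
    rw [NatTrans.naturality_apply η, hb]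
  · ext X x
    exact hb X x

end Semisimple

/-! ### Tensor products over `C` -/

noncomputable section Coend

universe w₁ w₂

variable {K : Type k} [Field K] {C : Type u} [Category.{v} C]

open scoped Classical in
/-- The relations `d s ⊗ x = s ⊗ x d`. -/
def coendRel (H : C ⥤ ModuleCat.{w₁} K) (G : Cᵒᵖ ⥤ ModuleCat.{w₂} K) :
    Submodule K (⨁ Z : C, H.obj Z ⊗[K] G.obj (op Z)) :=
  Submodule.span K
    {t | ∃ (Z Z' : C) (d : Z ⟶ Z') (s : H.obj Z) (x : G.obj (op Z')),
      t = DirectSum.lof K C (fun Z => H.obj Z ⊗[K] G.obj (op Z)) Z (s ⊗ₜ[K] G.map d.op x) -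
          DirectSum.lof K C (fun Z => H.obj Z ⊗[K] G.obj (op Z)) Z' (H.map d s ⊗ₜ[K] x)}

/-- The tensor product over `C` of a covariant functor `H` and a contravariant functor `G`. -/
def Coend (H : C ⥤ ModuleCat.{w₁} K) (G : Cᵒᵖ ⥤ ModuleCat.{w₂} K) : Type (max u w₁ w₂) :=
  (⨁ Z : C, H.obj Z ⊗[K] G.obj (op Z)) ⧸ coendRel H G

namespace Coend

instance (H : C ⥤ ModuleCat.{w₁} K) (G : Cᵒᵖ ⥤ ModuleCat.{w₂} K) : AddCommGroup (Coend H G) :=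
  inferInstanceAs (AddCommGroup (_ ⧸ coendRel H G))

instance (H : C ⥤ ModuleCat.{w₁} K) (G : Cᵒᵖ ⥤ ModuleCat.{w₂} K) : Module K (Coend H G) :=
  inferInstanceAs (Module K (_ ⧸ coendRel H G))

open scoped Classical in
/-- The projection to the tensor product over `C`. -/
def proj (H : C ⥤ ModuleCat.{w₁} K) (G : Cᵒᵖ ⥤ ModuleCat.{w₂} K) :
    (⨁ Z : C, H.obj Z ⊗[K] G.obj (op Z)) →ₗ[K] Coend H G :=
  (coendRel H G).mkQ

open scoped Classical in
/-- The class of `s ⊗ x`. -/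
def mk (H : C ⥤ ModuleCat.{w₁} K) (G : Cᵒᵖ ⥤ ModuleCat.{w₂} K) (Z : C) :
    H.obj Z →ₗ[K] G.obj (op Z) →ₗ[K] Coend H G :=
  (TensorProduct.mk K (H.obj Z) (G.obj (op Z))).compr₂
    (proj H G ∘ₗ DirectSum.lof K C (fun Z => H.obj Z ⊗[K] G.obj (op Z)) Z)

variable {H : C ⥤ ModuleCat.{w₁} K} {G : Cᵒᵖ ⥤ ModuleCat.{w₂} K}

theorem mk_map {Z Z' : C} (d : Z ⟶ Z') (s : H.obj Z) (x : G.obj (op Z')) :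
    mk H G Z' (H.map d s) x = mk H G Z s (G.map d.op x) := by
  classical
  refine Eq.symm ((Submodule.Quotient.eq (coendRel H G)).2
    (Submodule.subset_span ⟨Z, Z', d, s, x, ?_⟩))
  congr!

variable {P : Type*} [AddCommGroup P] [Module K P]

open scoped Classical in
theorem hom_ext {f g : Coend H G →ₗ[K] P}
    (h : ∀ Z s x, f (mk H G Z s x) = g (mk H G Z s x)) : f = g :=
  Submodule.linearMap_qext (coendRel H G) (DirectSum.linearMap_ext _ fun Z =>
    TensorProduct.ext' fun s x => h Z s x)

open scoped Classical in
/-- Linear maps out of the tensor product over `C` are balanced families of bilinear maps. -/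
def lift (φ : ∀ Z : C, H.obj Z →ₗ[K] G.obj (op Z) →ₗ[K] P)
    (hφ : ∀ (Z Z' : C) (d : Z ⟶ Z') (s : H.obj Z) (x : G.obj (op Z')),
      φ Z' (H.map d s) x = φ Z s (G.map d.op x)) : Coend H G →ₗ[K] P :=
  (coendRel H G).liftQ
    (DirectSum.toModule K C P fun Z => TensorProduct.lift (φ Z)) (by
      refine Submodule.span_le.2 ?_
      rintro _ ⟨Z, Z', d, s, x, rfl⟩
      simp [hφ Z Z' d s x])

theorem lift_mk (φ : ∀ Z : C, H.obj Z →ₗ[K] G.obj (op Z) →ₗ[K] P)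
    (hφ : ∀ (Z Z' : C) (d : Z ⟶ Z') (s : H.obj Z) (x : G.obj (op Z')),
      φ Z' (H.map d s) x = φ Z s (G.map d.op x)) (Z : C) (s : H.obj Z) (x : G.obj (op Z)) :
    lift φ hφ (mk H G Z s x) = φ Z s x := by
  classical
  refine (Submodule.liftQ_apply _ _ _).trans ?_
  simp

end Coend

end Coend

/-! ### Induced graded functors -/

noncomputable section Induced

variable (K : Type k) [Field K] {C : Type u} [Category.{v} C] [Preadditive C] [Linear K C]

namespace FreeTensorHom

theorem post_eq_comp {X Y Z : C} (f : Y ⟶ Z) (t : FreeTensorHom K X Y) :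
    post K X f t = comp K X Y Z t (ofHom K f) := (comp_ofHom K t f).symm

/-- The covariant functor `Hom (X, -)` of the free tensor category, restricted to `C`. -/
def functor (X : C) : C ⥤ ModuleCat.{max u v} K where
  obj Y := ModuleCat.of K (FreeTensorHom K X Y)
  map f := ModuleCat.ofHom (post K X f)
  map_id Y := by
    ext1
    refine LinearMap.ext fun t => ?_
    exact (post_eq_comp K _ _).trans (comp_one K t)
  map_comp f g := by
    ext1
    refine LinearMap.ext fun t => ?_
    change post K X (f ≫ g) t = post K X g (post K X f t)
    rw [post_eq_comp, post_eq_comp K f, ← comp_post, post_incl, tensorPower.map_of]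

/-- The projection to the elements of degree `i`. -/
def degProj (X Y : C) (i : ℤ) : FreeTensorHom K X Y →ₗ[K] FreeTensorHom K X Y :=
  DirectSum.toModule K ℕ _ fun n => if (n : ℤ) = i then incl K n else 0

theorem degProj_incl {X Y : C} (i : ℤ) (n : ℕ) (t : (tensorPower K X n).obj Y) :
    degProj K X Y i (incl K n t) = if (n : ℤ) = i then incl K n t else 0 := by
  rw [degProj, DirectSum.toModule_lof]
  split_ifs <;> rfl

theorem degProj_of_mem {X Y : C} {i : ℤ} {t : FreeTensorHom K X Y}
    (ht : t ∈ FreeTensorCat.degSubmodule K X Y i) : degProj K X Y i t = t := by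
  rcases lt_or_ge i 0 with hi | hi
  · rw [FreeTensorCat.eq_zero_of_mem K hi t ht, map_zero]
  lift i to ℕ using hi
  rw [FreeTensorCat.eq_incl_of_mem K i t ht, degProj_incl, if_pos rfl]

theorem degProj_of_mem_ne {X Y : C} {i j : ℤ} (hij : j ≠ i) {t : FreeTensorHom K X Y}
    (ht : t ∈ FreeTensorCat.degSubmodule K X Y j) : degProj K X Y i t = 0 := by
  rcases lt_or_ge j 0 with hj | hj
  · rw [FreeTensorCat.eq_zero_of_mem K hj t ht, map_zero]
  lift j to ℕ using hj
  rw [FreeTensorCat.eq_incl_of_mem K j t ht, degProj_incl, if_neg hij]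

theorem degProj_post {X Y Z : C} (i : ℤ) (f : Y ⟶ Z) (t : FreeTensorHom K X Y) :
    degProj K X Z i (post K X f t) = post K X f (degProj K X Y i t) := by
  induction t using DirectSum.induction_on with
  | zero => simp
  | add s t hs ht => simp only [map_add, hs, ht]
  | of n t =>
    change degProj K X Z i (post K X f (incl K n t)) = post K X f (degProj K X Y i (incl K n t))
    rw [post_incl, degProj_incl, degProj_incl]
    split_ifs
    · rw [post_incl]
    · rw [map_zero]

theorem ofHom_eq_zero {X Y : C} (f : X ⟶ Y) (hf : f ∈ (catRadical K C).carrier X Y) :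
    ofHom K f = 0 := by
  have : tensorPower.of K f = 0 := congrArg ULift.up ((Submodule.Quotient.mk_eq_zero _).2 hf)
  rw [ofHom, this, map_zero]

end FreeTensorHom

namespace GrFunctor

variable {K}

section Action

variable (E : GrFunctor.{k, max u v, u, w} K (FreeTensorCat K C))

/-- The action of the morphisms of the free tensor category, as a bilinear map. -/
def act {X Y : C} : FreeTensorHom K X Y →ₗ[K] E.toFunctor.obj (op ⟨Y⟩) →ₗ[K]
    E.toFunctor.obj (op ⟨X⟩) where
  toFun s := (E.toFunctor.map (Quiver.Hom.op (V := FreeTensorCat K C) (X := ⟨X⟩) (Y := ⟨Y⟩) s)).hom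
  map_add' s t := congrArg ModuleCat.Hom.hom (E.map_add (X := ⟨X⟩) (Y := ⟨Y⟩) s t)
  map_smul' c s := congrArg ModuleCat.Hom.hom (E.map_smul (X := ⟨X⟩) (Y := ⟨Y⟩) c s)

variable {E}

theorem act_comp {X Y Z : C} (s : FreeTensorHom K X Y) (t : FreeTensorHom K Y Z)
    (x : E.toFunctor.obj (op ⟨Z⟩)) :
    E.act (FreeTensorHom.comp K X Y Z s t) x = E.act s (E.act t x) :=
  congrArg (fun φ => φ.hom x) (E.toFunctor.map_comp
    (Quiver.Hom.op (V := FreeTensorCat K C) (X := ⟨Y⟩) (Y := ⟨Z⟩) t)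
    (Quiver.Hom.op (V := FreeTensorCat K C) (X := ⟨X⟩) (Y := ⟨Y⟩) s))

theorem act_one {X : C} (x : E.toFunctor.obj (op ⟨X⟩)) :
    E.act (FreeTensorHom.ofHom K (𝟙 X)) x = x :=
  congrArg (fun φ => φ.hom x) (E.toFunctor.map_id (op ⟨X⟩))

theorem act_mem {X Y : C} {i j : ℤ} {s : FreeTensorHom K X Y}
    (hs : s ∈ FreeTensorCat.degSubmodule K X Y i) {x : E.toFunctor.obj (op ⟨Y⟩)}
    (hx : x ∈ E.deg ⟨Y⟩ j) : E.act s x ∈ E.deg ⟨X⟩ (i + j) :=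
  E.map_mem (X := ⟨X⟩) (Y := ⟨Y⟩) s hs x hx

theorem act_ofHom_mem {X Y : C} {j : ℤ} (f : X ⟶ Y) {x : E.toFunctor.obj (op ⟨Y⟩)}
    (hx : x ∈ E.deg ⟨Y⟩ j) : E.act (FreeTensorHom.ofHom K f) x ∈ E.deg ⟨X⟩ j := by
  have := act_mem (FreeTensorCat.incl_mem K 0 (tensorPower.of K f)) hx
  rwa [Nat.cast_zero, zero_add] at this

theorem app_act {F : GrFunctor.{k, max u v, u, w} K (FreeTensorCat K C)} (η : E ⟶ F) {X Y : C}
    (s : FreeTensorHom K X Y) (x : E.toFunctor.obj (op ⟨Y⟩)) :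
    η.natTrans.app (op ⟨X⟩) (E.act s x) = F.act s (η.natTrans.app (op ⟨Y⟩) x) :=
  NatTrans.naturality_apply η.natTrans _ x

variable (E) in
/-- The elements of degree `j`, as a functor on `C`. -/
def component (j : ℤ) : Cᵒᵖ ⥤ ModuleCat.{w} K where
  obj X := ModuleCat.of K (E.deg ⟨X.unop⟩ j)
  map f := ModuleCat.ofHom <|
    (E.act (FreeTensorHom.ofHom K f.unop)).restrict fun _ hx => act_ofHom_mem f.unop hx
  map_id X := ModuleCat.hom_ext <| LinearMap.ext fun x => Subtype.ext <| act_one x.1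
  map_comp f g := ModuleCat.hom_ext <| LinearMap.ext fun x => Subtype.ext <| by
    change E.act (FreeTensorHom.ofHom K (g.unop ≫ f.unop)) x.1 =
      E.act (FreeTensorHom.ofHom K g.unop) (E.act (FreeTensorHom.ofHom K f.unop) x.1)
    rw [← act_comp, FreeTensorHom.comp_ofHom, FreeTensorHom.post_incl, tensorPower.map_of]

theorem coe_component_map {j : ℤ} {X Y : C} (f : X ⟶ Y) (x : E.deg ⟨Y⟩ j) :
    ((show E.deg ⟨X⟩ j from (E.component j).map f.op x) : E.toFunctor.obj (op ⟨X⟩)) =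
      E.act (FreeTensorHom.ofHom K f) x.1 := rfl

theorem isRadModule_component (j : ℤ) : IsRadModule (E.component j) where
  map_add f g := ModuleCat.hom_ext <| LinearMap.ext fun x => Subtype.ext <| by
    change E.act (FreeTensorHom.ofHom K (f + g)) x.1 =
      E.act (FreeTensorHom.ofHom K f) x.1 + E.act (FreeTensorHom.ofHom K g) x.1
    simp only [FreeTensorHom.ofHom, _root_.map_add, LinearMap.add_apply]
  map_smul c f := ModuleCat.hom_ext <| LinearMap.ext fun x => Subtype.ext <| by
    change E.act (FreeTensorHom.ofHom K (c • f)) x.1 = c • E.act (FreeTensorHom.ofHom K f) x.1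
    simp only [FreeTensorHom.ofHom, _root_.map_smul, LinearMap.smul_apply]
  map_rad f hf := ModuleCat.hom_ext <| LinearMap.ext fun x => Subtype.ext <| by
    change E.act (FreeTensorHom.ofHom K f) x.1 = 0
    rw [FreeTensorHom.ofHom_eq_zero K f hf, map_zero, LinearMap.zero_apply]

/-- The map induced by a natural transformation on the elements of degree `j`. -/
def componentMap {F : GrFunctor.{k, max u v, u, w} K (FreeTensorCat K C)} (η : E ⟶ F) (j : ℤ) :
    E.component j ⟶ F.component j where
  app X := ModuleCat.ofHom <|
    (η.natTrans.app (op ⟨X.unop⟩)).hom.restrict fun x hx => η.deg_mem ⟨X.unop⟩ j x hx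
  naturality _ _ _ := ModuleCat.hom_ext <| LinearMap.ext fun x => Subtype.ext <|
    app_act η _ x.1

end Action

section Ind

variable {ι : Type} [DecidableEq ι] (G : ι → Cᵒᵖ ⥤ ModuleCat.{max u v} K)

/-- The value at `X` of the functor induced from the family `G` of contravariant functors on `C`:
the direct sum of the tensor products of `Hom (X, -)` and `G i` over `C`. -/
def IndObj (X : C) : Type (max u v) := ⨁ i, Coend (FreeTensorHom.functor K X) (G i)

namespace IndObj

instance (X : C) : AddCommGroup (IndObj G X) :=
  inferInstanceAs (AddCommGroup (⨁ i, Coend (FreeTensorHom.functor K X) (G i)))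

instance (X : C) : Module K (IndObj G X) :=
  inferInstanceAs (Module K (⨁ i, Coend (FreeTensorHom.functor K X) (G i)))

/-- The inclusion of the summand of index `i`. -/
def incl (i : ι) (X : C) : Coend (FreeTensorHom.functor K X) (G i) →ₗ[K] IndObj G X :=
  DirectSum.lof K ι (fun i => Coend (FreeTensorHom.functor K X) (G i)) i

/-- The element `s ⊗ x` of the summand of index `i`. -/
def mk (i : ι) {X Z : C} :
    FreeTensorHom K X Z →ₗ[K] (G i).obj (op Z) →ₗ[K] IndObj G X :=
  (Coend.mk (FreeTensorHom.functor K X) (G i) Z).compr₂ (incl G i X)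

variable {G}

theorem mk_post (i : ι) {X Z Z' : C} (d : Z ⟶ Z') (s : FreeTensorHom K X Z)
    (x : (G i).obj (op Z')) :
    mk G i (FreeTensorHom.post K X d s) x = mk G i s ((G i).map d.op x) :=
  congrArg (incl G i X)
    (Coend.mk_map (H := FreeTensorHom.functor K X) (G := G i) d s x)

variable {P : Type*} [AddCommGroup P] [Module K P]

theorem hom_ext {X : C} {f g : IndObj G X →ₗ[K] P}
    (h : ∀ (i : ι) (Z : C) (s : FreeTensorHom K X Z) (x : (G i).obj (op Z)),
      f (mk G i s x) = g (mk G i s x)) : f = g :=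
  DirectSum.linearMap_ext _ fun i => Coend.hom_ext fun Z s x => h i Z s x

/-- Linear maps out of the induced functor are balanced families of bilinear maps. -/
def lift {X : C} (φ : ∀ (i : ι) (Z : C), FreeTensorHom K X Z →ₗ[K] (G i).obj (op Z) →ₗ[K] P)
    (hφ : ∀ (i : ι) (Z Z' : C) (d : Z ⟶ Z') (s : FreeTensorHom K X Z) (x : (G i).obj (op Z')),
      φ i Z' (FreeTensorHom.post K X d s) x = φ i Z s ((G i).map d.op x)) :
    IndObj G X →ₗ[K] P :=
  DirectSum.toModule K ι P fun i =>
    Coend.lift (H := FreeTensorHom.functor K X) (fun Z => φ i Z) fun Z Z' d s x => hφ i Z Z' d s x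

theorem lift_mk {X : C}
    (φ : ∀ (i : ι) (Z : C), FreeTensorHom K X Z →ₗ[K] (G i).obj (op Z) →ₗ[K] P)
    (hφ : ∀ (i : ι) (Z Z' : C) (d : Z ⟶ Z') (s : FreeTensorHom K X Z) (x : (G i).obj (op Z')),
      φ i Z' (FreeTensorHom.post K X d s) x = φ i Z s ((G i).map d.op x))
    (i : ι) (Z : C) (s : FreeTensorHom K X Z) (x : (G i).obj (op Z)) :
    lift φ hφ (mk G i s x) = φ i Z s x :=
  (DirectSum.toModule_lof K i _).trans
    (Coend.lift_mk (H := FreeTensorHom.functor K X) (fun Z => φ i Z) _ Z s x)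

/-- The action of a morphism of the free tensor category. -/
def act {X Y : C} (a : FreeTensorHom K X Y) : IndObj G Y →ₗ[K] IndObj G X :=
  lift (fun i Z => mk G i (Z := Z) ∘ₗ FreeTensorHom.comp K X Y Z a) fun i Z Z' d s x => by
    rw [LinearMap.comp_apply, LinearMap.comp_apply, FreeTensorHom.comp_post, mk_post]

theorem act_mk {X Y : C} (a : FreeTensorHom K X Y) (i : ι) {Z : C} (s : FreeTensorHom K Y Z)
    (x : (G i).obj (op Z)) :
    act a (mk G i s x) = mk G i (FreeTensorHom.comp K X Y Z a s) x :=
  lift_mk _ _ i Z s x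

variable (G) in
/-- The elements of degree `m`, if the elements of `G i` are given the degree `δ i`. -/
def degSubmodule (δ : ι → ℤ) (X : C) (m : ℤ) : Submodule K (IndObj G X) :=
  Submodule.span K {t | ∃ (l : ℤ) (i : ι) (Z : C) (s : FreeTensorHom K X Z)
    (x : (G i).obj (op Z)), s ∈ FreeTensorCat.degSubmodule K X Z l ∧ l + δ i = m ∧
      t = mk G i s x}

theorem degSubmodule_isInternal (δ : ι → ℤ) (X : C) :
    DirectSum.IsInternal (degSubmodule G δ X) := by
  -- The elements of degree `m` in the summand of index `i` have tensor degree `m - δ i`.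
  let π : ℤ → IndObj G X →ₗ[K] IndObj G X := fun m =>
    lift (fun i Z => mk G i (Z := Z) ∘ₗ FreeTensorHom.degProj K X Z (m - δ i))
      fun i Z Z' d s x => by
        rw [LinearMap.comp_apply, LinearMap.comp_apply, FreeTensorHom.degProj_post, mk_post]
  have hπ : ∀ m i Z (s : FreeTensorHom K X Z) (x : (G i).obj (op Z)), π m (mk G i s x) =
      mk G i (FreeTensorHom.degProj K X Z (m - δ i) s) x := fun m i Z s x => lift_mk _ _ i Z s x
  refine isInternal_of_projections _ ?_ π (fun m t ht => ?_) fun m m' hm t ht => ?_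
  · rw [← Submodule.ker_mkQ (⨆ m, degSubmodule G δ X m), LinearMap.ker_eq_top]
    refine hom_ext fun i Z s x => ?_
    induction s using DirectSum.induction_on with
    | zero => simp
    | add s t hs ht => simp only [_root_.map_add, LinearMap.add_apply, hs, ht]
    | of n t =>
      refine (Submodule.Quotient.mk_eq_zero _).2 (Submodule.mem_iSup_of_mem (n + δ i) ?_)
      exact Submodule.subset_span ⟨n, i, Z, _, x, FreeTensorCat.incl_mem K n t, rfl, rfl⟩
  · induction ht using Submodule.span_induction with
    | zero => exact map_zero _
    | add s t _ _ hs ht => rw [_root_.map_add, hs, ht]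
    | smul c t _ ht => rw [_root_.map_smul, ht]
    | mem t ht =>
      obtain ⟨l, i, Z, s, x, hs, rfl, rfl⟩ := ht
      rw [hπ, add_sub_cancel_right, FreeTensorHom.degProj_of_mem K hs]
  · induction ht using Submodule.span_induction with
    | zero => exact map_zero _
    | add s t _ _ hs ht => rw [_root_.map_add, hs, ht, add_zero]
    | smul c t _ ht => rw [_root_.map_smul, ht, smul_zero]
    | mem t ht =>
      obtain ⟨l, i, Z, s, x, hs, rfl, rfl⟩ := ht
      rw [hπ, FreeTensorHom.degProj_of_mem_ne K (by omega) hs, map_zero, LinearMap.zero_apply]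

end IndObj

/-- The graded functor induced from the family `G` of contravariant functors on `C`, where the
elements of `G i` have degree `δ i`. -/
def ind (δ : ι → ℤ) : GrFunctor.{k, max u v, u, max u v} K (FreeTensorCat K C) where
  toFunctor :=
    { obj := fun X => ModuleCat.of K (IndObj G X.unop.base)
      map := fun f => ModuleCat.ofHom (IndObj.act f.unop)
      map_id := fun X => ModuleCat.hom_ext <| IndObj.hom_ext fun i Z s x =>
        (IndObj.act_mk _ i s x).trans
          (congrArg (fun s => IndObj.mk G i s x) (FreeTensorHom.one_comp K s))
      map_comp := fun f g => ModuleCat.hom_ext <| IndObj.hom_ext fun i Z s x => by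
        refine (IndObj.act_mk _ i s x).trans (Eq.symm ?_)
        refine (congrArg (IndObj.act g.unop) (IndObj.act_mk f.unop i s x)).trans ?_
        refine (IndObj.act_mk _ i _ x).trans ?_
        exact (congrArg (fun s => IndObj.mk G i s x) (FreeTensorHom.comp_assoc K _ _ s)).symm }
  map_add f g := ModuleCat.hom_ext <| IndObj.hom_ext fun i Z s x => by
    refine (IndObj.act_mk _ i s x).trans (Eq.symm ?_)
    refine (congrArg₂ (· + ·) (IndObj.act_mk f i s x) (IndObj.act_mk g i s x)).trans ?_
    refine Eq.trans ?_ (congrArg (fun s => IndObj.mk G i s x)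
      ((FreeTensorHom.comp K _ _ Z).map_add₂ f g s)).symm
    simp only [_root_.map_add, LinearMap.add_apply]
  map_smul c f := ModuleCat.hom_ext <| IndObj.hom_ext fun i Z s x => by
    refine (IndObj.act_mk _ i s x).trans (Eq.symm ?_)
    refine (congrArg (c • ·) (IndObj.act_mk f i s x)).trans ?_
    refine Eq.trans ?_ (congrArg (fun s => IndObj.mk G i s x)
      ((FreeTensorHom.comp K _ _ Z).map_smul₂ c f s)).symm
    simp only [_root_.map_smul, LinearMap.smul_apply]
  deg X m := IndObj.degSubmodule G δ X.base m
  isInternal X := IndObj.degSubmodule_isInternal δ X.base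
  map_mem {X Y a b} f hf t ht := by
    change IndObj.act f t ∈ _
    induction ht using Submodule.span_induction with
    | zero => exact (map_zero (IndObj.act (G := G) f)).symm ▸ Submodule.zero_mem _
    | add s t _ _ hs ht =>
      exact (_root_.map_add (IndObj.act (G := G) f) s t).symm ▸ Submodule.add_mem _ hs ht
    | smul c t _ ht =>
      exact (_root_.map_smul (IndObj.act (G := G) f) c t).symm ▸ Submodule.smul_mem _ c ht
    | mem t ht =>
      obtain ⟨l, i, Z, s, x, hs, rfl, rfl⟩ := ht
      rw [IndObj.act_mk]
      exact Submodule.subset_span ⟨a + l, i, Z, _, x, FreeTensorCat.comp_mem K f s hf hs,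
        add_assoc _ _ _, rfl⟩

variable {G} {δ : ι → ℤ}

theorem ind_act_mk {X Y Z : C} (a : FreeTensorHom K X Y) (i : ι) (s : FreeTensorHom K Y Z)
    (x : (G i).obj (op Z)) :
    (ind G δ).act a (IndObj.mk G i s x) =
      IndObj.mk G i (FreeTensorHom.comp K X Y Z a s) x := IndObj.act_mk a i s x

theorem mk_one_mem (i : ι) {X : C} (x : (G i).obj (op X)) :
    IndObj.mk G i (FreeTensorHom.ofHom K (𝟙 X)) x ∈ IndObj.degSubmodule G δ X (δ i) :=
  Submodule.subset_span ⟨0, i, X, _, x, FreeTensorCat.incl_mem K 0 _, zero_add _, rfl⟩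

/-- The induced functor is generated by the elements `1 ⊗ x`. -/
theorem mk_eq_act (i : ι) {X Z : C} (s : FreeTensorHom K X Z) (x : (G i).obj (op Z)) :
    IndObj.mk G i s x = (ind G δ).act s (IndObj.mk G i (FreeTensorHom.ofHom K (𝟙 Z)) x) := by
  rw [ind_act_mk, FreeTensorHom.comp_one]

/-- The inclusion of `G i` in the induced functor. -/
def indUnit (i : ι) : G i ⟶ (ind G δ).component (δ i) where
  app X := ModuleCat.ofHom <|
    (IndObj.mk G i (FreeTensorHom.ofHom K (𝟙 X.unop))).codRestrict
      (IndObj.degSubmodule G δ X.unop (δ i)) fun x => mk_one_mem i x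
  naturality X Y f := ModuleCat.hom_ext <| LinearMap.ext fun x => Subtype.ext <| by
    change IndObj.mk G i (FreeTensorHom.ofHom K (𝟙 Y.unop)) ((G i).map f.unop.op x) =
      (ind G δ).act (FreeTensorHom.ofHom K f.unop)
        (IndObj.mk G i (FreeTensorHom.ofHom K (𝟙 X.unop)) x)
    rw [ind_act_mk, FreeTensorHom.comp_one, ← IndObj.mk_post, FreeTensorHom.post_incl,
      tensorPower.map_of, Category.id_comp]

variable {E : GrFunctor.{k, max u v, u, max u v} K (FreeTensorCat K C)}

/-- Morphisms from an induced functor are determined by their values on the elements `1 ⊗ x`. -/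
theorem ind_hom_ext {f g : ind G δ ⟶ E}
    (h : ∀ (i : ι) (Z : C) (x : (G i).obj (op Z)),
      f.natTrans.app (op ⟨Z⟩) (IndObj.mk G i (FreeTensorHom.ofHom K (𝟙 Z)) x) =
        g.natTrans.app (op ⟨Z⟩) (IndObj.mk G i (FreeTensorHom.ofHom K (𝟙 Z)) x)) : f = g := by
  refine Hom.ext (NatTrans.ext (funext fun X => ModuleCat.hom_ext ?_))
  refine IndObj.hom_ext fun i Z s x => ?_
  rw [mk_eq_act (δ := δ)]
  exact (app_act f s _).trans ((congrArg _ (h i Z x)).trans (app_act g s _).symm)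

/-- Induction is left adjoint to restriction: a family of natural transformations on `C` from
`G i` to the elements of `E` of degree `δ i` extends to the induced functor. -/
def indDesc (φ : ∀ i, G i ⟶ E.component (δ i)) : ind G δ ⟶ E :=
  let ψ : ∀ X : C, IndObj G X →ₗ[K] E.toFunctor.obj (op ⟨X⟩) := fun X =>
    IndObj.lift (fun i Z => (E.act (X := X) (Y := Z)).compl₂
        ((E.deg ⟨Z⟩ (δ i)).subtype ∘ₗ ((φ i).app (op Z)).hom)) fun i Z Z' d s x => by
      change E.act _ (show E.deg ⟨Z'⟩ (δ i) from (φ i).app (op Z') x).1 =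
        E.act s (show E.deg ⟨Z⟩ (δ i) from (φ i).app (op Z) ((G i).map d.op x)).1
      rw [NatTrans.naturality_apply (φ i) d.op x]
      refine Eq.trans ?_ (congrArg _ (coe_component_map d _)).symm
      rw [← act_comp, FreeTensorHom.comp_ofHom]
  have hψ : ∀ (X : C) i Z (s : FreeTensorHom K X Z) (x : (G i).obj (op Z)),
      ψ X (IndObj.mk G i s x) = E.act s (show E.deg ⟨Z⟩ (δ i) from (φ i).app (op Z) x).1 :=
    fun X i Z s x => IndObj.lift_mk _ _ i Z s x
  { natTrans :=
      { app := fun X => ModuleCat.ofHom (ψ X.unop.base)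
        naturality := fun X Y f => ModuleCat.hom_ext <| IndObj.hom_ext fun i Z s x => by
          refine (congrArg (ψ Y.unop.base) (IndObj.act_mk f.unop i s x)).trans ?_
          rw [hψ]
          exact (act_comp f.unop s _).trans (congrArg (E.act f.unop) (hψ _ i Z s x)).symm }
    deg_mem := fun X m t ht => by
      change ψ X.base t ∈ _
      induction ht using Submodule.span_induction with
      | zero => exact (map_zero (ψ X.base)).symm ▸ Submodule.zero_mem _
      | add s t _ _ hs ht => exact (_root_.map_add (ψ X.base) s t).symm ▸ Submodule.add_mem _ hs ht
      | smul c t _ ht => exact (_root_.map_smul (ψ X.base) c t).symm ▸ Submodule.smul_mem _ c ht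
      | mem t ht =>
        obtain ⟨l, i, Z, s, x, hs, rfl, rfl⟩ := ht
        rw [hψ]
        exact act_mem hs (Subtype.prop _) }

theorem indDesc_mk (φ : ∀ i, G i ⟶ E.component (δ i)) (i : ι) {X Z : C}
    (s : FreeTensorHom K X Z) (x : (G i).obj (op Z)) :
    (indDesc φ).natTrans.app (op ⟨X⟩) (IndObj.mk G i s x) =
      E.act s (show E.deg ⟨Z⟩ (δ i) from (φ i).app (op Z) x).1 :=
  IndObj.lift_mk _ _ i Z s x

/-- By adjunction, a lifting problem for an induced functor is one for modules over `C / rad`. -/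
theorem projective_ind [HasFiniteBiproducts C] (hKS : IsKrullSchmidt C) :
    Projective (ind G δ) where
  factors {E F} f e _ := by
    have hs : ∀ j, ∃ s : F.component j ⟶ E.component j, s ≫ componentMap e j = 𝟙 _ := fun j =>
      exists_section hKS (isRadModule_component j) (isRadModule_component j) (componentMap e j)
        fun X x =>
          let ⟨y, hy, hyx⟩ := exists_mem_deg_app_eq e (surjective_of_epi e ⟨X.unop⟩) j x.1 x.2
          ⟨⟨y, hy⟩, Subtype.ext hyx⟩
    choose s hs using hs
    refine ⟨indDesc fun i => indUnit i ≫ componentMap f (δ i) ≫ s (δ i),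
      ind_hom_ext fun i Z x => ?_⟩
    refine (congrArg (e.natTrans.app (op ⟨Z⟩)) ((indDesc_mk _ i _ x).trans (act_one _))).trans ?_
    exact congrArg Subtype.val (congrArg (fun φ => φ.app (op Z)
      ((componentMap f (δ i)).app (op Z) ((indUnit i).app (op Z) x))) (hs (δ i)))

end Ind

end GrFunctor

end Induced

/-! ### The standard resolution -/

noncomputable section Resolution

variable (K : Type k) [Field K] {C : Type u} [Category.{v} C] [Preadditive C] [Linear K C]

theorem GrHom.pre_id (n : ℕ) {X Y : C} (m : GrHom K n X Y) :
    GrHom.pre K n (𝟙 X) Y m = m := by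
  induction m using Submodule.Quotient.induction_on with
  | H m => exact congrArg (Submodule.Quotient.mk) (Subtype.ext (Category.id_comp _))

theorem GrHom.pre_comp (n : ℕ) {X Y Z W : C} (f : X ⟶ Y) (g : Y ⟶ Z) (m : GrHom K n Z W) :
    GrHom.pre K n (f ≫ g) W m = GrHom.pre K n f W (GrHom.pre K n g W m) := by
  induction m using Submodule.Quotient.induction_on with
  | H m => exact congrArg (Submodule.Quotient.mk) (Subtype.ext (Category.assoc _ _ _))

/-- The functor `(rad / rad ^ 2) (X, -)`. -/
def radFunctor (X : C) : C ⥤ ModuleCat.{v} K where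
  obj Y := ModuleCat.of K (RadBimod K X Y)
  map f := ModuleCat.ofHom (GrHom.post K 1 X f)
  map_id _ := ModuleCat.hom_ext <| LinearMap.ext fun m => GrHom.post_id K 1 m
  map_comp f g := ModuleCat.hom_ext <| LinearMap.ext fun m => GrHom.post_comp K 1 f g m

/-- The functor `(rad / rad ^ 2) (-, X)`. -/
def radYoneda (X : C) : Cᵒᵖ ⥤ ModuleCat.{max u v} K where
  obj Y := ModuleCat.of K (ULift.{u} (RadBimod K Y.unop X))
  map f := ModuleCat.ofHom <| ULift.moduleEquiv.symm.toLinearMap ∘ₗ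
    GrHom.pre K 1 f.unop X ∘ₗ ULift.moduleEquiv.toLinearMap
  map_id _ := ModuleCat.hom_ext <| LinearMap.ext fun m =>
    congrArg ULift.up (GrHom.pre_id K 1 m.down)
  map_comp f g := ModuleCat.hom_ext <| LinearMap.ext fun m =>
    congrArg ULift.up (GrHom.pre_comp K 1 g.unop f.unop m.down)

variable {K}

/-- The value at `X` of the tensor product over `C` of the contravariant functor `G` with the
bimodule `rad / rad ^ 2`. -/
def RadTensorObj (G : Cᵒᵖ ⥤ ModuleCat.{max u v} K) (X : C) : Type (max u v) :=
  Coend (radFunctor K X) G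

namespace RadTensorObj

instance (G : Cᵒᵖ ⥤ ModuleCat.{max u v} K) (X : C) : AddCommGroup (RadTensorObj G X) :=
  inferInstanceAs (AddCommGroup (Coend (radFunctor K X) G))

instance (G : Cᵒᵖ ⥤ ModuleCat.{max u v} K) (X : C) : Module K (RadTensorObj G X) :=
  inferInstanceAs (Module K (Coend (radFunctor K X) G))

variable (G : Cᵒᵖ ⥤ ModuleCat.{max u v} K)

/-- The class of `a ⊗ x`. -/
def mk {X Z : C} : RadBimod K X Z →ₗ[K] G.obj (op Z) →ₗ[K] RadTensorObj G X :=
  Coend.mk (radFunctor K X) G Z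

theorem mk_post {X Z Z' : C} (d : Z ⟶ Z') (a : RadBimod K X Z) (x : G.obj (op Z')) :
    mk G (GrHom.post K 1 X d a) x = mk G a (G.map d.op x) :=
  Coend.mk_map (H := radFunctor K X) d a x

variable {G} {P : Type*} [AddCommGroup P] [Module K P]

theorem hom_ext {X : C} {f g : RadTensorObj G X →ₗ[K] P}
    (h : ∀ (Z : C) (a : RadBimod K X Z) (x : G.obj (op Z)), f (mk G a x) = g (mk G a x)) :
    f = g :=
  Coend.hom_ext (H := radFunctor K X) h

theorem map_mem {X : C} (f : RadTensorObj G X →ₗ[K] P) (S : Submodule K P)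
    (h : ∀ (Z : C) (a : RadBimod K X Z) (x : G.obj (op Z)), f (mk G a x) ∈ S)
    (t : RadTensorObj G X) : f t ∈ S := by
  have : S.mkQ ∘ₗ f = 0 := hom_ext fun Z a x => (Submodule.Quotient.mk_eq_zero _).2 (h Z a x)
  exact (Submodule.Quotient.mk_eq_zero _).1 (LinearMap.congr_fun this t)

/-- Linear maps out of the tensor product over `C` are balanced families of bilinear maps. -/
def lift {X : C} (φ : ∀ Z : C, RadBimod K X Z →ₗ[K] G.obj (op Z) →ₗ[K] P)
    (hφ : ∀ (Z Z' : C) (d : Z ⟶ Z') (a : RadBimod K X Z) (x : G.obj (op Z')),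
      φ Z' (GrHom.post K 1 X d a) x = φ Z a (G.map d.op x)) : RadTensorObj G X →ₗ[K] P :=
  Coend.lift (H := radFunctor K X) φ hφ

theorem lift_mk {X : C} (φ : ∀ Z : C, RadBimod K X Z →ₗ[K] G.obj (op Z) →ₗ[K] P)
    (hφ : ∀ (Z Z' : C) (d : Z ⟶ Z') (a : RadBimod K X Z) (x : G.obj (op Z')),
      φ Z' (GrHom.post K 1 X d a) x = φ Z a (G.map d.op x)) {Z : C} (a : RadBimod K X Z)
    (x : G.obj (op Z)) : lift φ hφ (mk G a x) = φ Z a x :=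
  Coend.lift_mk (H := radFunctor K X) φ hφ Z a x

variable (G) in
/-- The map `a ⊗ x ↦ (a ∘ f) ⊗ x`. -/
def pre {X Y : C} (f : X ⟶ Y) : RadTensorObj G Y →ₗ[K] RadTensorObj G X :=
  lift (fun Z => mk G ∘ₗ GrHom.pre K 1 f Z) fun Z Z' d a x => by
    rw [LinearMap.comp_apply, LinearMap.comp_apply, ← GrHom.post_pre, mk_post]

theorem pre_mk {X Y Z : C} (f : X ⟶ Y) (a : RadBimod K Y Z) (x : G.obj (op Z)) :
    pre G f (mk G a x) = mk G (GrHom.pre K 1 f Z a) x :=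
  lift_mk _ _ a x

end RadTensorObj

/-- The tensor product over `C` of a contravariant functor with the bimodule `rad / rad ^ 2`. -/
def radTensor (G : Cᵒᵖ ⥤ ModuleCat.{max u v} K) : Cᵒᵖ ⥤ ModuleCat.{max u v} K where
  obj X := ModuleCat.of K (RadTensorObj G X.unop)
  map f := ModuleCat.ofHom (RadTensorObj.pre G f.unop)
  map_id X := ModuleCat.hom_ext <| RadTensorObj.hom_ext fun Z a x =>
    (RadTensorObj.pre_mk _ a x).trans
      (congrArg (fun a => RadTensorObj.mk G a x) (GrHom.pre_id K 1 a))
  map_comp f g := ModuleCat.hom_ext <| RadTensorObj.hom_ext fun Z a x => by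
    change RadTensorObj.pre G (g.unop ≫ f.unop) (RadTensorObj.mk G a x) =
      RadTensorObj.pre G g.unop (RadTensorObj.pre G f.unop (RadTensorObj.mk G a x))
    rw [RadTensorObj.pre_mk, RadTensorObj.pre_mk, RadTensorObj.pre_mk, GrHom.pre_comp]

namespace FreeTensorHom

/-- The elements of `rad / rad ^ 2`, as morphisms of degree `1` of the free tensor category. -/
def arrow {X Y : C} : RadBimod K X Y →ₗ[K] FreeTensorHom K X Y :=
  incl K 1 ∘ₗ (tensorPower.mk K 0).flip (tensorPower.of K (𝟙 X))

theorem arrow_eq_cons {X Y : C} (a : RadBimod K X Y) : arrow a = cons K a (ofHom K (𝟙 X)) :=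
  (cons_incl K a 0 _).symm

theorem comp_arrow {X Y Z : C} (s : FreeTensorHom K X Y) (a : RadBimod K Y Z) :
    comp K X Y Z s (arrow a) = cons K a s := by
  rw [arrow_eq_cons, comp_cons, comp_one]

theorem arrow_mem {X Y : C} (a : RadBimod K X Y) :
    arrow a ∈ FreeTensorCat.degSubmodule K X Y 1 :=
  FreeTensorCat.incl_mem K 1 _

theorem arrow_pre {X Y Z : C} (f : X ⟶ Y) (a : RadBimod K Y Z) :
    arrow (GrHom.pre K 1 f Z a) = comp K X Y Z (ofHom K f) (arrow a) := by
  rw [comp_arrow, cons_incl]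
  refine congrArg (incl K 1) ((TensorObj.mk_pre K (tensorPower K X 0) f a _).trans ?_)
  exact congrArg (tensorPower.mk K 0 a) (congrArg (tensorPower.of K) (Category.id_comp f))

theorem arrow_post {X Y Z : C} (f : Y ⟶ Z) (a : RadBimod K X Y) :
    arrow (GrHom.post K 1 X f a) = comp K X Y Z (arrow a) (ofHom K f) := by
  rw [comp_ofHom]
  exact ((post_incl K f 1 _).trans (congrArg (incl K 1) (tensorPower.map_mk K 0 a _ f))).symm

end FreeTensorHom

namespace GrFunctor

section RadAct

variable (F : GrFunctor.{k, max u v, u, w} K (FreeTensorCat K C))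

/-- The action of `rad / rad ^ 2` on the elements of degree `j`. -/
def radActDeg (j : ℤ) (X Y : C) :
    RadBimod K X Y →ₗ[K] F.deg ⟨Y⟩ j →ₗ[K] F.deg ⟨X⟩ (1 + j) :=
  LinearMap.mk₂ K
    (fun a x => ⟨F.act (FreeTensorHom.arrow a) x.1, act_mem (FreeTensorHom.arrow_mem a) x.2⟩)
    (fun a b x => Subtype.ext (by
      simp only [_root_.map_add, LinearMap.add_apply, Submodule.coe_add]))
    (fun c a x => Subtype.ext (by
      simp only [_root_.map_smul, LinearMap.smul_apply, Submodule.coe_smul]))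
    (fun a x y => Subtype.ext (_root_.map_add (F.act (FreeTensorHom.arrow a)) _ _))
    (fun c a x => Subtype.ext (_root_.map_smul (F.act (FreeTensorHom.arrow a)) _ _))

/-- The action of `rad / rad ^ 2` on the elements of degree `j`, in terms of the restriction
of `F` to `C`. -/
def radAct (j : ℤ) {X Y : C} : RadBimod K X Y →ₗ[K] (F.component j).obj (op Y) →ₗ[K]
    (F.component (1 + j)).obj (op X) :=
  F.radActDeg j X Y

theorem radAct_pre (j : ℤ) {X Y Z : C} (f : X ⟶ Y) (a : RadBimod K Y Z)
    (x : (F.component j).obj (op Z)) :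
    F.radAct j (GrHom.pre K 1 f Z a) x = (F.component (1 + j)).map f.op (F.radAct j a x) :=
  Subtype.ext <| by
    refine Eq.trans ?_ (act_comp (E := F) (FreeTensorHom.ofHom K f) (FreeTensorHom.arrow a) _)
    rw [← FreeTensorHom.arrow_pre]
    rfl

theorem radAct_post (j : ℤ) {X Y Z : C} (f : Y ⟶ Z) (a : RadBimod K X Y)
    (x : (F.component j).obj (op Z)) :
    F.radAct j (GrHom.post K 1 X f a) x = F.radAct j a ((F.component j).map f.op x) :=
  Subtype.ext <| by
    refine Eq.trans ?_ (act_comp (E := F) (FreeTensorHom.arrow a) (FreeTensorHom.ofHom K f) _)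
    rw [← FreeTensorHom.arrow_post]
    rfl

end RadAct

section Sequence

variable (F : GrFunctor.{k, max u v, u, max u v} K (FreeTensorCat K C))

/-- The functor induced from the restriction of `F` to `C`. -/
abbrev indRes : GrFunctor.{k, max u v, u, max u v} K (FreeTensorCat K C) :=
  ind (fun j : ℤ => F.component j) fun j => j

/-- The functor induced from the tensor product of the restriction of `F` to `C` with
`rad / rad ^ 2`. -/
abbrev indRad : GrFunctor.{k, max u v, u, max u v} K (FreeTensorCat K C) :=
  ind (fun j : ℤ => radTensor (F.component j)) fun j => 1 + j

/-- The action map `s ⊗ x ↦ x s`. -/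
def counit : F.indRes ⟶ F := indDesc (δ := fun j : ℤ => j) fun j => 𝟙 (F.component j)

theorem counit_mk {X Z : C} (j : ℤ) (s : FreeTensorHom K X Z)
    (x : (F.component j).obj (op Z)) :
    F.counit.natTrans.app (op ⟨X⟩) (IndObj.mk (fun j : ℤ => F.component j) j s x) =
      F.act s (show F.deg ⟨Z⟩ j from x).1 :=
  indDesc_mk (δ := fun j : ℤ => j) (fun j => 𝟙 (F.component j)) j s x

/-- The map `a ⊗ x ↦ 1 ⊗ x a - a ⊗ x`. -/
def syzygyAux (j : ℤ) (X : C) :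
    RadTensorObj (F.component j) X →ₗ[K] IndObj (fun j : ℤ => F.component j) X :=
  RadTensorObj.lift
    (fun Z => (F.radAct j (X := X) (Y := Z)).compr₂
        (IndObj.mk (fun j : ℤ => F.component j) (1 + j) (FreeTensorHom.ofHom K (𝟙 X))) -
      IndObj.mk (fun j : ℤ => F.component j) j ∘ₗ FreeTensorHom.arrow) fun Z Z' d a x => by
    simp only [LinearMap.sub_apply, LinearMap.compr₂_apply, LinearMap.comp_apply]
    rw [F.radAct_post, FreeTensorHom.arrow_post, FreeTensorHom.comp_ofHom, IndObj.mk_post]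

theorem syzygyAux_mk (j : ℤ) {X Z : C} (a : RadBimod K X Z) (x : (F.component j).obj (op Z)) :
    F.syzygyAux j X (RadTensorObj.mk _ a x) =
      IndObj.mk (fun j : ℤ => F.component j) (1 + j) (FreeTensorHom.ofHom K (𝟙 X))
        (F.radAct j a x) -
      IndObj.mk (fun j : ℤ => F.component j) j (FreeTensorHom.arrow a) x :=
  RadTensorObj.lift_mk _ _ a x

theorem syzygyAux_mem (j : ℤ) (X : C) (t : RadTensorObj (F.component j) X) :
    F.syzygyAux j X t ∈
      IndObj.degSubmodule (fun j : ℤ => F.component j) (fun j => j) X (1 + j) := by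
  refine RadTensorObj.map_mem _ _ (fun Z a x => ?_) t
  rw [syzygyAux_mk]
  refine Submodule.sub_mem _ (mk_one_mem (δ := fun j => j) (1 + j) _) ?_
  exact Submodule.subset_span ⟨1, j, Z, _, x, FreeTensorHom.arrow_mem a, rfl, rfl⟩

theorem act_syzygyAux_mk (j : ℤ) {X Y Z : C} (s : FreeTensorHom K X Y) (a : RadBimod K Y Z)
    (x : (F.component j).obj (op Z)) :
    IndObj.act s (F.syzygyAux j Y (RadTensorObj.mk _ a x)) =
      IndObj.mk (fun j : ℤ => F.component j) (1 + j) s (F.radAct j a x) -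
      IndObj.mk (fun j : ℤ => F.component j) j (FreeTensorHom.cons K a s) x := by
  rw [syzygyAux_mk, map_sub, IndObj.act_mk, IndObj.act_mk, FreeTensorHom.comp_one,
    FreeTensorHom.comp_arrow]

/-- The map `s ⊗ a ⊗ x ↦ s ⊗ x a - a s ⊗ x` in the standard resolution of `F`. -/
def syzygy : F.indRad ⟶ F.indRes := indDesc fun j =>
  { app := fun X => ModuleCat.ofHom <| (F.syzygyAux j X.unop).codRestrict
      (IndObj.degSubmodule (fun j : ℤ => F.component j) (fun j => j) X.unop (1 + j))
      (F.syzygyAux_mem j X.unop)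
    naturality := fun X Y f => ModuleCat.hom_ext <| RadTensorObj.hom_ext fun Z a x =>
      Subtype.ext <| by
        change F.syzygyAux j Y.unop (RadTensorObj.pre _ f.unop (RadTensorObj.mk _ a x)) =
          IndObj.act (FreeTensorHom.ofHom K f.unop)
            (F.syzygyAux j X.unop (RadTensorObj.mk _ a x))
        rw [act_syzygyAux_mk, RadTensorObj.pre_mk, syzygyAux_mk, F.radAct_pre,
          FreeTensorHom.arrow_pre, ← IndObj.mk_post, FreeTensorHom.post_incl, tensorPower.map_of,
          Category.id_comp, FreeTensorHom.comp_arrow] }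

/-- The elements `s ⊗ a ⊗ x` of the first term of the standard resolution of `F`. -/
def radMk (j : ℤ) {X Y : C} : FreeTensorHom K X Y →ₗ[K] RadTensorObj (F.component j) Y →ₗ[K]
    IndObj (fun j : ℤ => radTensor (F.component j)) X :=
  IndObj.mk (fun j : ℤ => radTensor (F.component j)) j

theorem radMk_post (j : ℤ) {X Y Y' : C} (d : Y ⟶ Y') (s : FreeTensorHom K X Y)
    (t : RadTensorObj (F.component j) Y') :
    F.radMk j (FreeTensorHom.post K X d s) t = F.radMk j s (RadTensorObj.pre _ d t) :=
  IndObj.mk_post (G := fun j : ℤ => radTensor (F.component j)) j d s t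

variable (X : C)

/-- The action map at `X`, as a linear map. -/
def counitApp : IndObj (fun j : ℤ => F.component j) X →ₗ[K] F.toFunctor.obj (op ⟨X⟩) :=
  (F.counit.natTrans.app (op ⟨X⟩)).hom

/-- The value of `syzygy` at `X`, as a linear map. -/
def syzygyApp : IndObj (fun j : ℤ => radTensor (F.component j)) X →ₗ[K]
    IndObj (fun j : ℤ => F.component j) X :=
  (F.syzygy.natTrans.app (op ⟨X⟩)).hom

variable {X}

theorem counitApp_mk {Z : C} (j : ℤ) (s : FreeTensorHom K X Z)
    (x : (F.component j).obj (op Z)) :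
    F.counitApp X (IndObj.mk (fun j : ℤ => F.component j) j s x) =
      F.act s (show F.deg ⟨Z⟩ j from x).1 :=
  F.counit_mk j s x

theorem syzygyApp_mk {Y Z : C} (j : ℤ) (s : FreeTensorHom K X Y) (a : RadBimod K Y Z)
    (x : (F.component j).obj (op Z)) :
    F.syzygyApp X (F.radMk j s (RadTensorObj.mk _ a x)) =
      IndObj.mk (fun j : ℤ => F.component j) (1 + j) s (F.radAct j a x) -
      IndObj.mk (fun j : ℤ => F.component j) j (FreeTensorHom.cons K a s) x :=
  (indDesc_mk _ j s _).trans (F.act_syzygyAux_mk j s a x)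

theorem indRad_hom_ext {P : Type*} [AddCommGroup P] [Module K P]
    {f g : IndObj (fun j : ℤ => radTensor (F.component j)) X →ₗ[K] P}
    (h : ∀ (j : ℤ) (Y Z : C) (s : FreeTensorHom K X Y) (a : RadBimod K Y Z)
      (x : (F.component j).obj (op Z)),
      f (F.radMk j s (RadTensorObj.mk _ a x)) = g (F.radMk j s (RadTensorObj.mk _ a x))) :
    f = g := by
  refine IndObj.hom_ext fun j Y s w => ?_
  have : f ∘ₗ F.radMk j s = g ∘ₗ F.radMk j s := RadTensorObj.hom_ext fun Z a x => h j Y Z s a x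
  exact LinearMap.congr_fun this w

end Sequence

end GrFunctor

end Resolution

/-! ### The contracting homotopy -/

noncomputable section Homotopy

variable {K : Type k} [Field K] {C : Type u} [Category.{v} C] [Preadditive C] [Linear K C]

/-- The map `(a, s, x) ↦ f (s, g (a, x))`. -/
def trilinearComp {A S V W P : Type*} [AddCommGroup A] [Module K A] [AddCommGroup S] [Module K S]
    [AddCommGroup V] [Module K V] [AddCommGroup W] [Module K W] [AddCommGroup P] [Module K P]
    (f : S →ₗ[K] W →ₗ[K] P) (g : A →ₗ[K] V →ₗ[K] W) : A →ₗ[K] S →ₗ[K] V →ₗ[K] P :=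
  (LinearMap.llcomp K V W P ∘ₗ f).flip ∘ₗ g

namespace GrFunctor

variable (F : GrFunctor.{k, max u v, u, max u v} K (FreeTensorCat K C))

/-- The inductive step in the construction of the contracting homotopy: the map
`(a, s, x) ↦ r (s ⊗ x a) - s ⊗ a ⊗ x`. -/
def homotopyStep (X : C) (n : ℕ)
    (r : ∀ j : ℤ, Coend (tensorPower K X n) (F.component j) →ₗ[K]
      IndObj (fun j : ℤ => radTensor (F.component j)) X) (j : ℤ) (Y Z : C) :
    RadBimod K Y Z →ₗ[K] (tensorPower K X n).obj Y →ₗ[K] (F.component j).obj (op Z) →ₗ[K]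
      IndObj (fun j : ℤ => radTensor (F.component j)) X :=
  trilinearComp ((Coend.mk (tensorPower K X n) (F.component (1 + j)) Y).compr₂ (r (1 + j)))
      (F.radAct j) -
    trilinearComp (F.radMk j (Y := Y) ∘ₗ FreeTensorHom.incl K n) (RadTensorObj.mk (F.component j))

variable (X : C) (n : ℕ) (r : ∀ j : ℤ, Coend (tensorPower K X n) (F.component j) →ₗ[K]
      IndObj (fun j : ℤ => radTensor (F.component j)) X) (j : ℤ)

theorem homotopyStep_apply (Y Z : C) (a : RadBimod K Y Z) (s : (tensorPower K X n).obj Y)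
    (x : (F.component j).obj (op Z)) :
    F.homotopyStep X n r j Y Z a s x =
      r (1 + j) (Coend.mk (tensorPower K X n) (F.component (1 + j)) Y s (F.radAct j a x)) -
      F.radMk j (FreeTensorHom.incl K n s) (RadTensorObj.mk (F.component j) a x) := rfl

theorem homotopyStep_pre (Y Y' Z : C) (d : Y ⟶ Y') (a : RadBimod K Y' Z)
    (s : (tensorPower K X n).obj Y) (x : (F.component j).obj (op Z)) :
    F.homotopyStep X n r j Y Z (GrHom.pre K 1 d Z a) s x =
      F.homotopyStep X n r j Y' Z a ((tensorPower K X n).map d s) x := by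
  rw [homotopyStep_apply, homotopyStep_apply, Coend.mk_map, F.radAct_pre,
    ← FreeTensorHom.post_incl, radMk_post, RadTensorObj.pre_mk]

theorem homotopyStep_post (Y Z Z' : C) (d : Z ⟶ Z') (a : RadBimod K Y Z)
    (s : (tensorPower K X n).obj Y) (x : (F.component j).obj (op Z')) :
    F.homotopyStep X n r j Y Z' (GrHom.post K 1 Y d a) s x =
      F.homotopyStep X n r j Y Z a s ((F.component j).map d.op x) := by
  rw [homotopyStep_apply, homotopyStep_apply, F.radAct_post, RadTensorObj.mk_post]

/-- The inductive step in the construction of the contracting homotopy, on the tensor product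
with a tensor power of `rad / rad ^ 2`. -/
def homotopySucc (Z : C) : (tensorPower K X (n + 1)).obj Z →ₗ[K]
    (F.component j).obj (op Z) →ₗ[K] IndObj (fun j : ℤ => radTensor (F.component j)) X :=
  TensorObj.lift K (tensorPower K X n) Z (fun Y => F.homotopyStep X n r j Y Z)
    fun Y Y' d a s => LinearMap.ext fun x => F.homotopyStep_pre X n r j Y Y' Z d a s x

theorem homotopySucc_mk (Y Z : C) (a : RadBimod K Y Z) (s : (tensorPower K X n).obj Y)
    (x : (F.component j).obj (op Z)) :
    F.homotopySucc X n r j Z (tensorPower.mk K n a s) x = F.homotopyStep X n r j Y Z a s x :=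
  LinearMap.congr_fun (TensorObj.lift_mk K (tensorPower K X n) Z
    (fun Y => F.homotopyStep X n r j Y Z)
    (fun Y Y' d a s => LinearMap.ext fun x => F.homotopyStep_pre X n r j Y Y' Z d a s x) a s) x

theorem homotopySucc_map (Z Z' : C) (d : Z ⟶ Z') (t : (tensorPower K X (n + 1)).obj Z)
    (x : (F.component j).obj (op Z')) :
    F.homotopySucc X n r j Z' ((tensorPower K X (n + 1)).map d t) x =
      F.homotopySucc X n r j Z t ((F.component j).map d.op x) := by
  have : (F.homotopySucc X n r j Z').flip x ∘ₗ ((tensorPower K X (n + 1)).map d).hom =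
      (F.homotopySucc X n r j Z).flip ((F.component j).map d.op x) := by
    refine tensorPower.hom_ext K fun Y a s => ?_
    refine (congrArg ((F.homotopySucc X n r j Z').flip x) (tensorPower.map_mk K n a s d)).trans ?_
    rw [LinearMap.flip_apply, LinearMap.flip_apply, homotopySucc_mk, homotopySucc_mk,
      homotopyStep_post]
  exact LinearMap.congr_fun this t

/-- The contracting homotopy, on elements of tensor degree `n`. -/
def homotopyDeg (X : C) : ∀ (n : ℕ) (j : ℤ), Coend (tensorPower K X n) (F.component j) →ₗ[K]
    IndObj (fun j : ℤ => radTensor (F.component j)) X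
  | 0, _ => 0
  | n + 1, j => Coend.lift (F.homotopySucc X n (homotopyDeg X n) j)
      (F.homotopySucc_map X n (homotopyDeg X n) j)

/-- The contracting homotopy `r` of the standard resolution of `F`, defined by `r (1 ⊗ x) = 0` and
`r (a s ⊗ x) = r (s ⊗ x a) - s ⊗ a ⊗ x`. It is only linear, not natural in `X`. -/
def homotopy : IndObj (fun j : ℤ => F.component j) X →ₗ[K]
    IndObj (fun j : ℤ => radTensor (F.component j)) X :=
  IndObj.lift (fun j Z => DirectSum.toModule K ℕ _ fun n =>
      (Coend.mk (tensorPower K X n) (F.component j) Z).compr₂ (F.homotopyDeg X n j))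
    fun j Z Z' d s x => by
      induction s using DirectSum.induction_on with
      | zero => simp
      | add s t hs ht => simp only [_root_.map_add, LinearMap.add_apply, hs, ht]
      | of n t =>
        rw [← DirectSum.lof_eq_of K, FreeTensorHom.post_incl, DirectSum.toModule_lof,
          DirectSum.toModule_lof]
        exact congrArg (F.homotopyDeg X n j) (Coend.mk_map d t x)

variable {X}

theorem homotopy_incl (Z : C) (s : (tensorPower K X n).obj Z)
    (x : (F.component j).obj (op Z)) :
    F.homotopy X (IndObj.mk (fun j : ℤ => F.component j) j (FreeTensorHom.incl K n s) x) =
      F.homotopyDeg X n j (Coend.mk (tensorPower K X n) (F.component j) Z s x) := by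
  refine (IndObj.lift_mk _ _ j Z _ x).trans ?_
  rw [DirectSum.toModule_lof, LinearMap.compr₂_apply]

theorem homotopy_ofHom {Z : C} (f : X ⟶ Z) (x : (F.component j).obj (op Z)) :
    F.homotopy X (IndObj.mk (fun j : ℤ => F.component j) j (FreeTensorHom.ofHom K f) x) = 0 := by
  rw [homotopy_incl]
  rfl

theorem homotopy_cons {Y Z : C} (a : RadBimod K Y Z) (s : FreeTensorHom K X Y)
    (x : (F.component j).obj (op Z)) :
    F.homotopy X (IndObj.mk (fun j : ℤ => F.component j) j (FreeTensorHom.cons K a s) x) =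
      F.homotopy X (IndObj.mk (fun j : ℤ => F.component j) (1 + j) s (F.radAct j a x)) -
        F.radMk j s (RadTensorObj.mk (F.component j) a x) := by
  induction s using DirectSum.induction_on with
  | zero => simp
  | add s t hs ht =>
    rw [_root_.map_add, _root_.map_add, _root_.map_add, _root_.map_add, LinearMap.add_apply,
      LinearMap.add_apply, LinearMap.add_apply, _root_.map_add, _root_.map_add, hs, ht]
    abel
  | of n t =>
    change F.homotopy X (IndObj.mk (fun j : ℤ => F.component j) j
        (FreeTensorHom.cons K a (FreeTensorHom.incl K n t)) x) =
      F.homotopy X (IndObj.mk (fun j : ℤ => F.component j) (1 + j) (FreeTensorHom.incl K n t) _) -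
        F.radMk j (FreeTensorHom.incl K n t) _
    rw [FreeTensorHom.cons_incl, homotopy_incl, homotopy_incl]
    refine (Coend.lift_mk _ (F.homotopySucc_map X n (F.homotopyDeg X n) j) Z _ x).trans ?_
    rw [homotopySucc_mk, homotopyStep_apply]

theorem homotopy_syzygyApp (t : IndObj (fun j : ℤ => radTensor (F.component j)) X) :
    F.homotopy X (F.syzygyApp X t) = t := by
  have : F.homotopy X ∘ₗ F.syzygyApp X = LinearMap.id := by
    refine F.indRad_hom_ext fun j Y Z s a x => ?_
    rw [LinearMap.comp_apply, syzygyApp_mk, map_sub, homotopy_cons, sub_sub_cancel]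
    rfl
  exact LinearMap.congr_fun this t

theorem counitApp_syzygyApp (t : IndObj (fun j : ℤ => radTensor (F.component j)) X) :
    F.counitApp X (F.syzygyApp X t) = 0 := by
  have : F.counitApp X ∘ₗ F.syzygyApp X = 0 := by
    refine F.indRad_hom_ext fun j Y Z s a x => ?_
    rw [LinearMap.comp_apply, syzygyApp_mk, map_sub, counitApp_mk, counitApp_mk,
      ← FreeTensorHom.comp_arrow, act_comp]
    exact sub_self _
  exact LinearMap.congr_fun this t

variable (X) in
/-- The map `x ↦ 1 ⊗ x`. -/
def unitSum : (⨁ j : ℤ, F.deg ⟨X⟩ j) →ₗ[K] IndObj (fun j : ℤ => F.component j) X :=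
  DirectSum.toModule K ℤ _ fun j =>
    IndObj.mk (fun j : ℤ => F.component j) j (FreeTensorHom.ofHom K (𝟙 X))

theorem unitSum_lof (x : (F.component j).obj (op X)) :
    F.unitSum X (DirectSum.lof K ℤ (fun j => F.deg ⟨X⟩ j) j x) =
      IndObj.mk (fun j : ℤ => F.component j) j (FreeTensorHom.ofHom K (𝟙 X)) x :=
  DirectSum.toModule_lof K j _

theorem counitApp_unitSum (x : ⨁ j : ℤ, F.deg ⟨X⟩ j) :
    F.counitApp X (F.unitSum X x) = DirectSum.coeLinearMap (F.deg ⟨X⟩) x := by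
  have : (F.counitApp X) ∘ₗ F.unitSum X =
      DirectSum.coeLinearMap (F.deg ⟨X⟩) := by
    refine DirectSum.linearMap_ext K fun j => LinearMap.ext fun x => ?_
    refine (congrArg (F.counitApp X) (F.unitSum_lof j x)).trans ?_
    exact ((F.counitApp_mk j _ x).trans (act_one _)).trans
      (DirectSum.coeLinearMap_lof (F.deg ⟨X⟩) j x).symm
  exact LinearMap.congr_fun this x

/-- Modulo the image of `syzygy`, every element of `F ⊗ T` is a sum of elements `1 ⊗ x`. -/
theorem sub_syzygyApp_homotopy_mem (t : IndObj (fun j : ℤ => F.component j) X) :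
    t - (F.syzygyApp X) (F.homotopy X t) ∈ LinearMap.range (F.unitSum X) := by
  let p : IndObj (fun j : ℤ => F.component j) X →ₗ[K] IndObj (fun j : ℤ => F.component j) X :=
    LinearMap.id - (F.syzygyApp X) ∘ₗ F.homotopy X
  have hp : ∀ t, p t = t - (F.syzygyApp X) (F.homotopy X t) := fun _ => rfl
  have key : ∀ {Z : C} (s : FreeTensorHom K X Z) (j : ℤ) (x : (F.component j).obj (op Z)),
      p (IndObj.mk (fun j : ℤ => F.component j) j s x) ∈ LinearMap.range (F.unitSum X) := by
    intro Z s
    induction s using FreeTensorHom.induction with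
    | zero => intro j x; simp
    | add s t hs ht =>
      intro j x
      rw [_root_.map_add, LinearMap.add_apply, _root_.map_add]
      exact Submodule.add_mem _ (hs j x) (ht j x)
    | of f =>
      intro j x
      rw [hp, homotopy_ofHom, map_zero, sub_zero]
      refine ⟨DirectSum.lof K ℤ (fun j => F.deg ⟨X⟩ j) j ((F.component j).map f.op x), ?_⟩
      rw [unitSum_lof]
      refine (IndObj.mk_post j f (FreeTensorHom.ofHom K (𝟙 X)) x).symm.trans ?_
      rw [FreeTensorHom.post_incl, tensorPower.map_of, Category.id_comp]
    | cons a s ih =>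
      intro j x
      have h := ih (1 + j) (F.radAct j a x)
      rw [hp] at h ⊢
      rw [homotopy_cons]
      convert h using 1
      rw [map_sub, syzygyApp_mk]
      abel
  have : (LinearMap.range (F.unitSum X)).mkQ ∘ₗ p = 0 := IndObj.hom_ext fun j Z s x =>
    (Submodule.Quotient.mk_eq_zero _).2 (key s j x)
  exact (Submodule.Quotient.mk_eq_zero _).1 (LinearMap.congr_fun this t)

theorem exists_syzygyApp_eq (t : IndObj (fun j : ℤ => F.component j) X)
    (ht : F.counitApp X t = 0) : ∃ s, F.syzygyApp X s = t := by
  obtain ⟨x, hx⟩ := F.sub_syzygyApp_homotopy_mem t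
  have h0 : DirectSum.coeLinearMap (F.deg ⟨X⟩) x = 0 := by
    rw [← counitApp_unitSum, hx, map_sub, counitApp_syzygyApp, ht, sub_zero]
  have hx0 : x = 0 := (F.isInternal ⟨X⟩).1 (h0.trans (map_zero _).symm)
  rw [hx0, map_zero] at hx
  exact ⟨F.homotopy X t, (sub_eq_zero.1 hx.symm).symm⟩

theorem isShortExact_syzygy_counit : IsShortExact F.syzygy F.counit := by
  rintro ⟨X⟩
  refine ⟨Function.LeftInverse.injective (F.homotopy_syzygyApp (X := X)), fun t =>
    ⟨fun ht => F.exists_syzygyApp_eq t ht, ?_⟩, fun y => ?_⟩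
  · rintro ⟨t, rfl⟩
    exact F.counitApp_syzygyApp t
  · obtain ⟨x, hx⟩ := (F.isInternal ⟨X⟩).2 y
    exact ⟨F.unitSum X x, (F.counitApp_unitSum x).trans hx⟩

theorem hasProjDimLE_one [HasFiniteBiproducts C] (hKS : IsKrullSchmidt C) : F.HasProjDimLE 1 :=
  ⟨F.indRad, F.indRes, F.syzygy, F.counit, projective_ind hKS, F.isShortExact_syzygy_counit,
    projective_ind hKS⟩

end GrFunctor

end Homotopy

/-! ### The radical of a representable functor -/

noncomputable section RadicalProjective

variable {K : Type k} [Field K] {C : Type u} [Category.{v} C] [Preadditive C] [Linear K C]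

namespace GrFunctor

/-- The functor induced from `(rad / rad ^ 2) (-, X)`, placed in degree `1`. -/
abbrev indRadYoneda (K : Type k) [Field K] {C : Type u} [Category.{v} C] [Preadditive C]
    [Linear K C] (X : C) : GrFunctor.{k, max u v, u, max u v} K (FreeTensorCat K C) :=
  ind (fun _ : Unit => radYoneda K X) fun _ => 1

/-- The element `s ⊗ a` of the functor induced from `(rad / rad ^ 2) (-, X)`. -/
def yonedaMk {X Y Z : C} : RadBimod K Z X →ₗ[K] FreeTensorHom K Y Z →ₗ[K]
    IndObj (fun _ : Unit => radYoneda K X) Y :=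
  (IndObj.mk (fun _ : Unit => radYoneda K X) () (X := Y) (Z := Z)).flip ∘ₗ
    (ULift.moduleEquiv (R := K) (M := RadBimod K Z X)).symm.toLinearMap

theorem yonedaMk_pre {X Y Z Z' : C} (d : Z ⟶ Z') (a : RadBimod K Z' X) (s : FreeTensorHom K Y Z) :
    yonedaMk (GrHom.pre K 1 d X a) s = yonedaMk a (FreeTensorHom.post K Y d s) :=
  (IndObj.mk_post (G := fun _ : Unit => radYoneda K X) () d s (ULift.up a)).symm

theorem act_yonedaMk {X Y Y' Z : C} (t : FreeTensorHom K Y' Y) (a : RadBimod K Z X)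
    (s : FreeTensorHom K Y Z) :
    IndObj.act t (yonedaMk a s) = yonedaMk a (FreeTensorHom.comp K Y' Y Z t s) :=
  IndObj.act_mk t () s _

/-- The map `a s ↦ s ⊗ a` from `Hom (Y, X)` to the functor induced from
`(rad / rad ^ 2) (-, X)`; it is zero in degree `0`. -/
def uncons (X Y : C) : FreeTensorHom K Y X →ₗ[K] IndObj (fun _ : Unit => radYoneda K X) Y :=
  DirectSum.toModule K ℕ _ fun
    | 0 => 0
    | n + 1 => TensorObj.lift K (tensorPower K Y n) X
        (fun Z => (yonedaMk (X := X) (Y := Y) (Z := Z)).compl₂ (FreeTensorHom.incl K n))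
        fun Z Z' d a s => by
          rw [LinearMap.compl₂_apply, LinearMap.compl₂_apply, yonedaMk_pre,
            FreeTensorHom.post_incl]

theorem uncons_incl_zero {X Y : C} (t : (tensorPower K Y 0).obj X) :
    uncons X Y (FreeTensorHom.incl K 0 t) = 0 := by
  rw [uncons, DirectSum.toModule_lof]
  rfl

theorem uncons_cons {X Y Z : C} (a : RadBimod K Z X) (s : FreeTensorHom K Y Z) :
    uncons X Y (FreeTensorHom.cons K a s) = yonedaMk a s := by
  induction s using DirectSum.induction_on with
  | zero => rw [map_zero, map_zero, map_zero]
  | add s t hs ht => simp only [_root_.map_add, hs, ht]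
  | of n t =>
    rw [← DirectSum.lof_eq_of K, FreeTensorHom.cons_incl, uncons, DirectSum.toModule_lof]
    exact TensorObj.lift_mk K (tensorPower K Y n) X _ _ a t

/-- The morphisms of positive degree are sums of composites `a s` with `a` of degree `1`. -/
theorem incl_succ_mem_span_cons {X Y : C} (n : ℕ) (t : (tensorPower K Y (n + 1)).obj X) :
    FreeTensorHom.incl K (n + 1) t ∈ Submodule.span K {f | ∃ (Z : C) (a : RadBimod K Z X)
      (s : FreeTensorHom K Y Z), s ∈ FreeTensorCat.degSubmodule K Y Z n ∧
        f = FreeTensorHom.cons K a s} := by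
  set S := Submodule.span K {f | ∃ (Z : C) (a : RadBimod K Z X)
      (s : FreeTensorHom K Y Z), s ∈ FreeTensorCat.degSubmodule K Y Z n ∧
        f = FreeTensorHom.cons K a s}
  have : S.mkQ ∘ₗ FreeTensorHom.incl K (n + 1) = 0 := tensorPower.hom_ext K fun Z a s =>
    (Submodule.Quotient.mk_eq_zero _).2 <| Submodule.subset_span
      ⟨Z, a, FreeTensorHom.incl K n s, FreeTensorCat.incl_mem K n s,
        (FreeTensorHom.cons_incl K a n s).symm⟩
  exact (Submodule.Quotient.mk_eq_zero _).1 (LinearMap.congr_fun this t)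

theorem uncons_mem {X Y : C} {j : ℤ} (f : FreeTensorHom K Y X)
    (hf : f ∈ FreeTensorCat.degSubmodule K Y X j) :
    uncons X Y f ∈ IndObj.degSubmodule (fun _ : Unit => radYoneda K X) (fun _ => 1) Y j := by
  rcases lt_or_ge j 0 with hj | hj
  · rw [FreeTensorCat.eq_zero_of_mem K hj f hf, map_zero]
    exact Submodule.zero_mem _
  lift j to ℕ using hj
  rw [FreeTensorCat.eq_incl_of_mem K j f hf]
  cases j with
  | zero =>
    rw [uncons_incl_zero]
    exact Submodule.zero_mem _
  | succ n =>
    have : Submodule.span K {f | ∃ (Z : C) (a : RadBimod K Z X)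
        (s : FreeTensorHom K Y Z), s ∈ FreeTensorCat.degSubmodule K Y Z n ∧
          f = FreeTensorHom.cons K a s} ≤
        (IndObj.degSubmodule (fun _ : Unit => radYoneda K X) (fun _ => 1) Y
          ((n + 1 : ℕ) : ℤ)).comap (uncons X Y) := by
      refine Submodule.span_le.2 ?_
      rintro _ ⟨Z, a, s, hs, rfl⟩
      rw [SetLike.mem_coe, Submodule.mem_comap, uncons_cons]
      exact Submodule.subset_span ⟨n, (), Z, s, ULift.up a, hs, by push_cast; rfl, rfl⟩
    exact this (incl_succ_mem_span_cons n (f (n + 1)))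

theorem mem_span_cons {X Y : C} (f : FreeTensorHom K Y X)
    (hf : f ∈ ⨆ j ≥ (1 : ℤ), FreeTensorCat.degSubmodule K Y X j) :
    f ∈ Submodule.span K {f | ∃ (Z : C) (a : RadBimod K Z X) (s : FreeTensorHom K Y Z),
      f = FreeTensorHom.cons K a s} := by
  suffices h : (⨆ j ≥ (1 : ℤ), FreeTensorCat.degSubmodule K Y X j) ≤ Submodule.span K
      {f | ∃ (Z : C) (a : RadBimod K Z X) (s : FreeTensorHom K Y Z),
        f = FreeTensorHom.cons K a s} from h hf
  refine iSup₂_le fun j hj f hf => ?_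
  obtain ⟨n, rfl⟩ : ∃ n : ℕ, j = ((n + 1 : ℕ) : ℤ) := ⟨(j - 1).toNat, by push_cast; omega⟩
  rw [FreeTensorCat.eq_incl_of_mem K _ f hf]
  refine Submodule.span_mono ?_ (incl_succ_mem_span_cons n _)
  rintro _ ⟨Z, a, s, -, rfl⟩
  exact ⟨Z, a, s, rfl⟩

theorem uncons_comp {X Y Y' : C} (t : FreeTensorHom K Y' Y) (f : FreeTensorHom K Y X)
    (hf : f ∈ ⨆ j ≥ (1 : ℤ), FreeTensorCat.degSubmodule K Y X j) :
    uncons X Y' (FreeTensorHom.comp K Y' Y X t f) = IndObj.act t (uncons X Y f) := by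
  have h := mem_span_cons f hf
  clear hf
  induction h using Submodule.span_induction with
  | zero => rw [map_zero, map_zero, map_zero, map_zero]
  | add f g _ _ hf hg => rw [_root_.map_add, _root_.map_add, _root_.map_add, _root_.map_add, hf, hg]
  | smul c f _ hf => rw [_root_.map_smul, _root_.map_smul, _root_.map_smul, _root_.map_smul, hf]
  | mem f hf =>
    obtain ⟨Z, a, s, rfl⟩ := hf
    rw [FreeTensorHom.comp_cons, uncons_cons, uncons_cons, act_yonedaMk]

variable (K) in
/-- The radical `rad (-, X)` of the representable functor `Hom (-, X)` of the free tensor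
category. -/
abbrev radRepresentable (X : C) : GrFunctor.{k, max u v, u, max u v} K (FreeTensorCat K C) :=
  (representable K (⟨X⟩ : FreeTensorCat K C)).truncGE 1

/-- The inclusion of `(rad / rad ^ 2) (Y, X)` in the radical of `Hom (-, X)`. -/
def radIncl (X Y : C) : RadBimod K Y X →ₗ[K] (radRepresentable K X).deg ⟨Y⟩ 1 :=
  (FreeTensorHom.arrow.codRestrict (⨆ j ≥ (1 : ℤ), FreeTensorCat.degSubmodule K Y X j)
    fun a => Submodule.mem_iSup_of_mem 1 (Submodule.mem_iSup_of_mem le_rfl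
      (FreeTensorHom.arrow_mem a))).codRestrict ((FreeTensorCat.degSubmodule K Y X 1).comap
        (⨆ j ≥ (1 : ℤ), FreeTensorCat.degSubmodule K Y X j).subtype)
    fun a => FreeTensorHom.arrow_mem a

/-- The natural inclusion of `(rad / rad ^ 2) (-, X)` in the radical of `Hom (-, X)`. -/
def radInclNat (X : C) : radYoneda K X ⟶ (radRepresentable K X).component 1 where
  app Y := ModuleCat.ofHom (radIncl X Y.unop ∘ₗ ULift.moduleEquiv.toLinearMap)
  naturality _ _ f := ModuleCat.hom_ext <| LinearMap.ext fun a =>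
    Subtype.ext <| Subtype.ext <| FreeTensorHom.arrow_pre f.unop a.down

/-- The map `s ⊗ a ↦ a s` to the radical of `Hom (-, X)`. -/
def radDesc (X : C) : indRadYoneda K X ⟶ radRepresentable K X :=
  indDesc (δ := fun _ => 1) fun _ => radInclNat X

/-- The map `s ⊗ a ↦ a s` to `Hom (Y, X)`, as a linear map. -/
def radDescApp (X Y : C) : IndObj (fun _ : Unit => radYoneda K X) Y →ₗ[K] FreeTensorHom K Y X :=
  (⨆ j ≥ (1 : ℤ), FreeTensorCat.degSubmodule K Y X j).subtype ∘ₗ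
    ((radDesc X).natTrans.app (op ⟨Y⟩)).hom

theorem coe_radRepresentable_act {X Y Z : C} (s : FreeTensorHom K Y Z)
    (f : (⨆ j ≥ (1 : ℤ), FreeTensorCat.degSubmodule K Z X j : Submodule K _)) :
    (⨆ j ≥ (1 : ℤ), FreeTensorCat.degSubmodule K Y X j).subtype
      ((radRepresentable K X).act s f) = FreeTensorHom.comp K Y Z X s f.1 := rfl

theorem radDescApp_yonedaMk {X Y Z : C} (a : RadBimod K Z X) (s : FreeTensorHom K Y Z) :
    radDescApp X Y (yonedaMk a s) = FreeTensorHom.cons K a s := by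
  have h : (radDesc X).natTrans.app (op ⟨Y⟩) (yonedaMk a s) =
      (radRepresentable K X).act s (radIncl X Z a).1 :=
    indDesc_mk (E := radRepresentable K X) (δ := fun _ => 1) (fun _ => radInclNat X) () s
      (ULift.up a)
  rw [← FreeTensorHom.comp_arrow]
  exact (congrArg (⨆ j ≥ (1 : ℤ), FreeTensorCat.degSubmodule K Y X j).subtype h).trans
    (coe_radRepresentable_act s (radIncl X Z a).1)

theorem radDescApp_uncons {X Y : C} (f : FreeTensorHom K Y X)
    (hf : f ∈ ⨆ j ≥ (1 : ℤ), FreeTensorCat.degSubmodule K Y X j) :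
    radDescApp X Y (uncons X Y f) = f := by
  have h := mem_span_cons f hf
  clear hf
  induction h using Submodule.span_induction with
  | zero => rw [map_zero, map_zero]
  | add f g _ _ hf hg => rw [_root_.map_add, _root_.map_add, hf, hg]
  | smul c f _ hf => rw [_root_.map_smul, _root_.map_smul, hf]
  | mem f hf =>
    obtain ⟨Z, a, s, rfl⟩ := hf
    rw [uncons_cons, radDescApp_yonedaMk]

/-- The map `a s ↦ s ⊗ a` from the radical of `Hom (-, X)`. -/
def radUncons (X : C) : radRepresentable K X ⟶ indRadYoneda K X where
  natTrans :=
    { app := fun Y => ModuleCat.ofHom (uncons X Y.unop.base ∘ₗ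
        (⨆ j ≥ (1 : ℤ), FreeTensorCat.degSubmodule K Y.unop.base X j).subtype)
      naturality := fun _ _ t => ModuleCat.hom_ext <| LinearMap.ext fun f =>
        uncons_comp t.unop f.1 f.2 }
  deg_mem _ _ f hf := uncons_mem f.1 hf

theorem radUncons_radDesc (X : C) : radUncons (K := K) X ≫ radDesc X = 𝟙 _ :=
  Hom.ext <| NatTrans.ext <| funext fun _ => ModuleCat.hom_ext <| LinearMap.ext fun f =>
    Subtype.ext (radDescApp_uncons f.1 f.2)

theorem projective_radRepresentable [HasFiniteBiproducts C] (hKS : IsKrullSchmidt C) (X : C) :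
    Projective (radRepresentable K X) :=
  have : Projective (indRadYoneda K X) := projective_ind hKS
  Retract.projective ⟨radUncons X, radDesc X, radUncons_radDesc X⟩

end GrFunctor

end RadicalProjective

theorem mainTheorem12 (K : Type k) [Field K] (C : Type u) [Category.{v} C] [Preadditive C]
    [Linear K C] [HasFiniteBiproducts C] [IsIdempotentComplete C] (hKS : IsKrullSchmidt C)
    (hfg : ∀ X : C, IsRadicalFinitelyGenerated K X)
    (hlf : IsAssociatedGradedLocallyFinite K C) :
    GrFunctor.HasGlobalDimLE.{k, max u v, u, max u v} K (FreeTensorCat K C) 1 ∧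
      ∀ X : FreeTensorCat K C,
        Projective ((GrFunctor.representable K X).truncGE 1) :=
  ⟨fun F => F.hasProjDimLE_one hKS, fun X => GrFunctor.projective_radRepresentable hKS X.base⟩
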